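/- A Cappell--Shaneson (CS) matrix is a matrix $A\in SL(3,\mathbb{Z})$ with $\det(A-I)=1$. Two such matrices $A,B$ are similar if $B=PAP^{-1}$ for some $P\in SL(3,\mathbb{Z})$. For an integer $n$ put $f_n(x)=x^3-nx^2+(n-1)x-1$. For integers $c,d,n$ with $d\neq 0$ and $d\mid f_n(c)$ let \[ X_{c,d,n}=\begin{bmatrix}0&a&b\\0&c&d\\1&0&n-c\end{bmatrix}, \] where $a,b$ are the unique integers for which this is a CS matrix, namely $a=-f_n(c)/d$ and $b=(c-1)(n-c-1)$. Let $A_0=X_{1,1,2}$. Gompf equivalence is the equivalence relation on the set of CS matrices generated by similarity and by the moves between $X_{c,d,n}$ and $X_{c,d,n+kd}$, for all $(c,d,n)$ as above and all $k\in\mathbb{Z}$. **Theorem.** Let $n$ be an integer with $-64\le n\le 69$ or $n\in\{-73,-69,-67,-66,71,72,74,78\}$. Then Gompf's conjecture is true for trace $n$: every Cappell--Shaneson matrix with trace $n$ is Gompf equivalent to $A_0$. -/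

import Mathlib

open scoped MatrixGroups

namespace CappellShaneson

/-- A Cappell-Shaneson matrix: `A ∈ SL(3, ℤ)` with `det (A - I) = 1`. -/
def CSMatrix : Type :=
  {A : SL(3, ℤ) // ((A : Matrix (Fin 3) (Fin 3) ℤ) - 1).det = 1}

/-- The trace of a Cappell-Shaneson matrix. -/
def CSMatrix.trace (A : CSMatrix) : ℤ :=
  (A.1 : Matrix (Fin 3) (Fin 3) ℤ).trace

/-- Similarity over `SL(3, ℤ)`: `B = P A P⁻¹` for some `P ∈ SL(3, ℤ)`. -/
def CSMatrix.Similar (A B : CSMatrix) : Prop :=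
  ∃ P : SL(3, ℤ), B.1 = P * A.1 * P⁻¹

/-- The polynomial `f_n(x) = x ^ 3 - n x ^ 2 + (n - 1) x - 1` evaluated at the integer `x`. -/
def f (n x : ℤ) : ℤ := x ^ 3 - n * x ^ 2 + (n - 1) * x - 1

/-- The set `𝒞𝒮` of triples `(c, d, n)` of integers with `d ≠ 0` and `f_n(c) ≡ 0 (mod d)`. -/
@[ext]
structure CSTriple where
  c : ℤ
  d : ℤ
  n : ℤ
  d_ne_zero : d ≠ 0
  dvd : d ∣ f n c

namespace CSTriple

/-- The integer matrix with rows `(0, a, b)`, `(0, c, d)`, `(1, 0, n - c)`. -/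
def mat (a b c d n : ℤ) : Matrix (Fin 3) (Fin 3) ℤ :=
  !![0, a, b; 0, c, d; 1, 0, n - c]

theorem det_mat (a b c d n : ℤ) : (mat a b c d n).det = a * d - b * c := by
  simp [mat, Matrix.det_fin_three]

theorem det_mat_sub_one (a b c d n : ℤ) :
    (mat a b c d n - 1).det = a * d - b * c + b - c * (n - c) + n - 1 := by
  simp [mat, Matrix.det_fin_three]
  ring

/-- The upper-middle entry of the standard matrix; the division is exact. -/
def a (t : CSTriple) : ℤ := -(f t.n t.c / t.d)

/-- The upper-right entry of the standard matrix. -/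
def b (t : CSTriple) : ℤ := (t.c - 1) * (t.n - t.c - 1)

theorem a_mul_d (t : CSTriple) : t.a * t.d = -f t.n t.c := by
  rw [a, neg_mul, Int.ediv_mul_cancel t.dvd]

theorem det_mat_eq_one (t : CSTriple) : (mat t.a t.b t.c t.d t.n).det = 1 := by
  rw [det_mat, a_mul_d, b, f]
  ring

theorem det_mat_sub_one_eq_one (t : CSTriple) : (mat t.a t.b t.c t.d t.n - 1).det = 1 := by
  rw [det_mat_sub_one, a_mul_d, b, f]
  ring

/-- The standard Cappell-Shaneson matrix `X_{c,d,n}`, with rows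
`(0, a, b)`, `(0, c, d)`, `(1, 0, n - c)`. -/
def X (t : CSTriple) : CSMatrix :=
  ⟨⟨mat t.a t.b t.c t.d t.n, t.det_mat_eq_one⟩, t.det_mat_sub_one_eq_one⟩

/-- The entries `a`, `b` of `X_{c,d,n}` are the only ones for which a matrix of this shape
is a Cappell-Shaneson matrix. -/
theorem eq_a_and_eq_b (t : CSTriple) {a' b' : ℤ} (h₁ : (mat a' b' t.c t.d t.n).det = 1)
    (h₂ : (mat a' b' t.c t.d t.n - 1).det = 1) : a' = t.a ∧ b' = t.b := by
  rw [det_mat] at h₁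
  rw [det_mat_sub_one, h₁] at h₂
  have hb : b' = t.b := by rw [b]; linarith
  refine ⟨mul_right_cancel₀ t.d_ne_zero ?_, hb⟩
  rw [a_mul_d, f]
  rw [hb, b] at h₁
  linarith

/-- The triple `(c, d, n + k d)`, again an element of `𝒞𝒮`. -/
def shift (t : CSTriple) (k : ℤ) : CSTriple where
  c := t.c
  d := t.d
  n := t.n + k * t.d
  d_ne_zero := t.d_ne_zero
  dvd := by
    have h : f (t.n + k * t.d) t.c = f t.n t.c + t.d * (k * (t.c - t.c ^ 2)) := by
      simp only [f]
      ring
    rw [h]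
    exact dvd_add t.dvd (dvd_mul_right _ _)

/-- Gompf equivalence on `𝒞𝒮`: the equivalence relation generated by similarity of the
associated standard matrices and by `(c, d, n) ∼ (c, d, n + k d)`. -/
def GompfEquiv : CSTriple → CSTriple → Prop :=
  Relation.EqvGen fun s t => s.X.Similar t.X ∨ ∃ k : ℤ, t = s.shift k

end CSTriple

namespace CSMatrix

/-- The elementary move `X_{c,d,n} ↦ X_{c,d,n+kd}` between standard matrices. -/
def GompfMove (A B : CSMatrix) : Prop :=
  ∃ (t : CSTriple) (k : ℤ), A = t.X ∧ B = (t.shift k).X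

/-- Gompf equivalence of Cappell-Shaneson matrices: the equivalence relation generated by
similarity and by the moves between `X_{c,d,n}` and `X_{c,d,n+kd}`. -/
def GompfEquiv : CSMatrix → CSMatrix → Prop :=
  Relation.EqvGen fun A B => A.Similar B ∨ A.GompfMove B

theorem Similar.refl (A : CSMatrix) : A.Similar A := ⟨1, by simp⟩

theorem Similar.symm {A B : CSMatrix} (h : A.Similar B) : B.Similar A := by
  obtain ⟨P, hP⟩ := h
  exact ⟨P⁻¹, by rw [hP]; group⟩

theorem Similar.trans {A B C : CSMatrix} (h : A.Similar B) (h' : B.Similar C) :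
    A.Similar C := by
  obtain ⟨P, hP⟩ := h
  obtain ⟨Q, hQ⟩ := h'
  exact ⟨Q * P, by rw [hQ, hP]; group⟩

/-- On standard matrices, Gompf equivalence of matrices is Gompf equivalence on `𝒞𝒮`. -/
theorem gompfEquiv_X_iff (s t : CSTriple) : s.X.GompfEquiv t.X ↔ s.GompfEquiv t := by
  constructor
  · intro h
    have key : ∀ A B : CSMatrix, A.GompfEquiv B → A.Similar B ∨
        ∃ u v : CSTriple, A.Similar u.X ∧ u.GompfEquiv v ∧ v.X.Similar B := by
      intro A B hAB
      induction hAB with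
      | rel A B h =>
        rcases h with h | ⟨u, k, rfl, rfl⟩
        · exact Or.inl h
        · exact Or.inr ⟨u, u.shift k, .refl _, .rel _ _ (Or.inr ⟨k, rfl⟩), .refl _⟩
      | refl A => exact Or.inl (.refl A)
      | symm A B _ ih =>
        rcases ih with h | ⟨u, v, h₁, h₂, h₃⟩
        · exact Or.inl h.symm
        · exact Or.inr ⟨v, u, h₃.symm, .symm _ _ h₂, h₁.symm⟩
      | trans A B C _ _ ih₁ ih₂ =>
        rcases ih₁ with h | ⟨u, v, h₁, h₂, h₃⟩
        · rcases ih₂ with h' | ⟨u', v', h₁', h₂', h₃'⟩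
          · exact Or.inl (h.trans h')
          · exact Or.inr ⟨u', v', h.trans h₁', h₂', h₃'⟩
        · rcases ih₂ with h' | ⟨u', v', h₁', h₂', h₃'⟩
          · exact Or.inr ⟨u, v, h₁, h₂, h₃.trans h'⟩
          · exact Or.inr ⟨u, v', h₁, .trans _ _ _ h₂ (.trans _ _ _
              (.rel _ _ (Or.inl (h₃.trans h₁'))) h₂'), h₃'⟩
    rcases key _ _ h with h | ⟨u, v, h₁, h₂, h₃⟩
    · exact .rel _ _ (Or.inl h)
    · exact .trans _ _ _ (.rel _ _ (Or.inl h₁)) (.trans _ _ _ h₂ (.rel _ _ (Or.inl h₃)))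
  · intro h
    induction h with
    | rel u v h =>
      rcases h with h | ⟨k, rfl⟩
      · exact .rel _ _ (Or.inl h)
      · exact .rel _ _ (Or.inr ⟨u, k, rfl, rfl⟩)
    | refl u => exact .refl _
    | symm u v _ ih => exact .symm _ _ ih
    | trans u v w _ _ ih₁ ih₂ => exact .trans _ _ _ ih₁ ih₂

end CSMatrix

/-- The matrix `A_n = X_{1,1,n+2}`. -/
def matA (n : ℤ) : CSMatrix :=
  CSTriple.X ⟨1, 1, n + 2, one_ne_zero, one_dvd _⟩

/-- Gompf's conjecture for trace `n`: every Cappell-Shaneson matrix with trace `n` is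
Gompf equivalent to `A_0`. -/
def GompfConjectureTrueFor (n : ℤ) : Prop :=
  ∀ A : CSMatrix, A.trace = n → A.GompfEquiv (matA 0)

end CappellShaneson

/-! Let `θ` be a root of `f_n`. A matrix of trace `n` makes ℤ³ a module over ℤ[θ]. A Hessenberg
matrix with subdiagonal `(g, e)` records a basis `v₁, v₂, v₃` in which ℤ[θ]v₁ has index `g ^ 2 * e`,
and standard matrices are the case `g = 1`, with `d = e`. After scaling `v₁` to 1, the vector `s v₁
+ t v₂` is `-(X - tθ)/g` with `X = c t - g s`, so its index is `e / g` times the norm `|form n X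
t|`: this is `IsHess.plane`. Transposing and reversing the basis exchanges `g` and `e`
(`IsHess.reverse`), which gives a dual plane to choose vectors from.

Every lattice `X ≡ c Y mod g` has a vector with `hexForm ≤ g`, and `form ^ 2` is at most `κ *
hexForm ^ 3` with `κ = 4 (n + 2) ^ 2 / 27`. Hence the minimal indices `N`, `N'` of a matrix and its
transpose satisfy `N' ^ 2 ≤ κ N` and `N ^ 2 ≤ κ N'`, so both are at most `κ`
(`exists_small_isHess`). This leaves finitely many candidates for each trace.

Through a lattice vector `(X, Y)` with `|form n X Y| = d D`, a duality step passes from the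
transpose of a standard matrix with entry `d` to a standard matrix with entry `D`, and conversely.
On the untransposed side a Gompf move may then change `n` by multiples of `D`. Searches and a short
list of explicit chains reduce all candidates with `g = 1` to `d = 1`, to smaller `d`, or to traces
`m` with `|2 m - 5|` smaller. For `g = 3, 5, 7, 9` a cyclic vector in the dual plane leads to a
standard matrix, and that is handled the same way. The symmetry `A ↦ A (A - 1)⁻¹`, which sends `n`
to `5 - n`, supplies the small and negative traces. -/

namespace CappellShaneson

/-! ### Size of the cubic form on short lattice vectors -/

/-- The homogenization of `f n`. -/
def form (n X Y : ℤ) : ℤ := X ^ 3 - n * X ^ 2 * Y + (n - 1) * X * Y ^ 2 - Y ^ 3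

theorem form_one (n c : ℤ) : form n c 1 = f n c := by simp [form, f]

/-- The reduction form of a lattice vector. -/
def hexForm (X Y : ℤ) : ℤ := X ^ 2 - X * Y + Y ^ 2

theorem hexForm_nonneg (X Y : ℤ) : 0 ≤ hexForm X Y := by
  unfold hexForm; nlinarith [sq_nonneg (2 * X - Y), sq_nonneg Y]

theorem hexForm_pos {X Y : ℤ} (h : X ≠ 0 ∨ Y ≠ 0) : 0 < hexForm X Y := by
  unfold hexForm
  rcases h with h | h
  · have := sq_pos_of_ne_zero h
    nlinarith [sq_nonneg (2 * Y - X)]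
  · have := sq_pos_of_ne_zero h
    nlinarith [sq_nonneg (2 * X - Y)]

/-- The form splits as `6 * form = U + V`, where `U` combines two cubics `k`, `h` with `k ^ 2 + 27 h
^ 2 = 4 q ^ 3` and `V` is a linear form times `q`. Cauchy–Schwarz bounds `U`, and `U + V` is bounded
by a weighted square inequality. -/
theorem form_sq_le {n : ℤ} (hn : 3 ≤ n) (X Y : ℤ) :
    27 * form n X Y ^ 2 ≤ 4 * (n + 2) ^ 2 * hexForm X Y ^ 3 := by
  obtain ⟨s, hs⟩ : ∃ s : ℤ, s = 2 * n - 5 := ⟨_, rfl⟩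
  have hs1 : 1 ≤ s := by omega
  set q := hexForm X Y with hq
  have hq0 : 0 ≤ q := hexForm_nonneg X Y
  obtain ⟨h, hh⟩ : ∃ h, h = X * Y * (X - Y) := ⟨_, rfl⟩
  obtain ⟨k, hk⟩ : ∃ k, k = (X + Y) * (2 * X - Y) * (X - 2 * Y) := ⟨_, rfl⟩
  have h1 : k ^ 2 + 27 * h ^ 2 = 4 * q ^ 3 := by rw [hk, hh, hq, hexForm]; ring
  obtain ⟨U, hU⟩ : ∃ U, U = k - 3 * s * h := ⟨_, rfl⟩
  obtain ⟨V, hV⟩ : ∃ V, V = 4 * (X - 2 * Y) * q := ⟨_, rfl⟩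
  have h2 : 6 * form n X Y = U + V := by
    rw [hU, hV, hk, hh, hs, hq, hexForm, form]; ring
  have hU2 : 3 * U ^ 2 ≤ 4 * (3 + s ^ 2) * q ^ 3 := by
    have : 3 * U ^ 2 + (9 * h + k * s) ^ 2 = (3 + s ^ 2) * (k ^ 2 + 27 * h ^ 2) := by
      rw [hU]; ring
    rw [h1] at this
    nlinarith [sq_nonneg (9 * h + k * s)]
  have hV2 : V ^ 2 ≤ 64 * q ^ 3 := by
    have : V ^ 2 = 64 * q ^ 3 - 48 * (X * q) ^ 2 := by
      rw [hV, hq, hexForm]; ring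
    nlinarith [sq_nonneg (X * q)]
  -- The bounds for `|U|` and `|V|` are asymptotically in the ratio `s : 4√3`, and 7 approximates
  -- `4√3`; the weights are those with equality at `7 U = s V`.
  have h3 : 7 * s * (U + V) ^ 2 ≤ 7 * (s + 7) * U ^ 2 + s * (s + 7) * V ^ 2 := by
    nlinarith [sq_nonneg (7 * U - s * V)]
  have hq3 : 0 ≤ q ^ 3 := by positivity
  have h4 : 7 * (s + 7) * (3 * U ^ 2) ≤ 7 * (s + 7) * (4 * (3 + s ^ 2) * q ^ 3) :=
    mul_le_mul_of_nonneg_left hU2 (by positivity)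
  have h5 : 3 * s * (s + 7) * V ^ 2 ≤ 3 * s * (s + 7) * (64 * q ^ 3) :=
    mul_le_mul_of_nonneg_left hV2 (by positivity)
  have h6 : (7 * (s + 7) * (4 * (3 + s ^ 2)) + 3 * s * (s + 7) * 64) * q ^ 3
      ≤ 28 * s * (s + 9) ^ 2 * q ^ 3 :=
    mul_le_mul_of_nonneg_right (by nlinarith) hq3
  have h7 : 28 * s * (27 * form n X Y ^ 2) ≤ 28 * s * ((s + 9) ^ 2 * q ^ 3) := by
    have : 28 * s * (27 * form n X Y ^ 2) = 3 * (7 * s * (U + V) ^ 2) := by rw [← h2]; ring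
    rw [this]
    linarith
  have h8 := le_of_mul_le_mul_left h7 (by positivity)
  have : s + 9 = 2 * (n + 2) := by rw [hs]; ring
  rw [this] at h8
  linarith

/-- Each lattice `{(X, Y) | X ≡ c Y mod g}` contains a nonzero vector of small `hexForm`. -/
theorem exists_hexForm_le {g : ℤ} (hg : 0 < g) (c : ℤ) :
    ∃ X Y : ℤ, (X ≠ 0 ∨ Y ≠ 0) ∧ g ∣ X - c * Y ∧ hexForm X Y ≤ g := by
  classical
  let S : ℕ → Prop := fun m => ∃ X Y Z W : ℤ, g ∣ X - c * Y ∧ g ∣ Z - c * W ∧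
    X * W - Y * Z = g ∧ (hexForm X Y).toNat = m
  have hS : ∃ m, S m := ⟨_, g, 0, c, 1, by simp, by simp, by ring, rfl⟩
  -- Lagrange–Gauss reduction: the first vector of an oriented basis is chosen with minimal
  -- `hexForm`, then a multiple of it is subtracted from the second to make the mixed term `b` at
  -- most `q` in absolute value.
  obtain ⟨X, Y, Z, W, h1, h2, h3, h4⟩ := Nat.find_spec hS
  have hne : X ≠ 0 ∨ Y ≠ 0 := by
    by_contra! hc
    rw [hc.1, hc.2] at h3
    simp at h3; omega
  have hpos := hexForm_pos hne
  refine ⟨X, Y, hne, h1, ?_⟩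
  set q := hexForm X Y with hq
  obtain ⟨k, hk⟩ : ∃ k : ℤ, |2 * (X * Z) - X * W - Y * Z + 2 * (Y * W) - k * (2 * q)| ≤ q := by
    set b := 2 * (X * Z) - X * W - Y * Z + 2 * (Y * W)
    have h2q : 0 < 2 * q := by omega
    have e1 := Int.emod_add_mul_ediv b (2 * q)
    have e2 := Int.emod_nonneg b h2q.ne'
    have e3 := Int.emod_lt_of_pos b h2q
    rcases le_total (b % (2 * q)) q with h | h
    · refine ⟨b / (2 * q), abs_le.mpr ⟨?_, ?_⟩⟩ <;> nlinarith
    · refine ⟨b / (2 * q) + 1, abs_le.mpr ⟨?_, ?_⟩⟩ <;> nlinarith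
  obtain ⟨Z', hZ'⟩ : ∃ Z', Z' = Z - k * X := ⟨_, rfl⟩
  obtain ⟨W', hW'⟩ : ∃ W', W' = W - k * Y := ⟨_, rfl⟩
  have hb : (2 * (X * Z) - X * W - Y * Z + 2 * (Y * W) - k * (2 * q)) =
      2 * (X * Z') - X * W' - Y * Z' + 2 * (Y * W') := by
    rw [hZ', hW', hq, hexForm]; ring
  rw [hb] at hk
  set b := 2 * (X * Z') - X * W' - Y * Z' + 2 * (Y * W') with hbdef
  have hdet : X * W' - Y * Z' = g := by rw [hZ', hW', ← h3]; ring
  have hmin : q ≤ hexForm Z' W' := by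
    have : S (hexForm Z' W').toNat := by
      refine ⟨Z', W', -X, -Y, ?_, ?_, ?_, rfl⟩
      · have : Z' - c * W' = (Z - c * W) - k * (X - c * Y) := by rw [hZ', hW']; ring
        rw [this]
        exact dvd_sub h2 (h1.mul_left k)
      · have : -X - c * -Y = -(X - c * Y) := by ring
        rw [this]
        exact (dvd_neg).mpr h1
      · rw [← hdet]; ring
    have := Nat.find_min' hS this
    rw [← h4] at this
    have := hexForm_nonneg Z' W'
    omega
  -- Discriminant identity for a form of discriminant `-3`. With `|b| ≤ q ≤ hexForm Z' W'` it gives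
  -- `3 q ^ 2 ≤ 3 g ^ 2`.
  have key : 4 * q * hexForm Z' W' = b ^ 2 + 3 * g ^ 2 := by
    rw [hbdef, hq, ← hdet, hexForm, hexForm]; ring
  have hb2 : b ^ 2 ≤ q ^ 2 := sq_le_sq' (by linarith [(abs_le.mp hk).1]) (abs_le.mp hk).2
  have : q ^ 2 ≤ g ^ 2 := by nlinarith
  exact (le_abs_self q).trans (abs_le_of_sq_le_sq this hg.le)

end CappellShaneson

/-! ### Similarity and Hessenberg matrices -/

namespace CappellShaneson

namespace CSMatrix

theorem similar_iff (A B : CSMatrix) :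
    A.Similar B ↔ ∃ P : SL(3, ℤ), (A.1 * P : Matrix (Fin 3) (Fin 3) ℤ) = P * B.1 := by
  constructor
  · rintro ⟨P, hP⟩
    have key : ∀ a p : SL(3, ℤ), a * p⁻¹ = p⁻¹ * (p * a * p⁻¹) := fun a p => by group
    refine ⟨P⁻¹, ?_⟩
    rw [hP]
    exact congrArg Subtype.val (key A.1 P)
  · rintro ⟨P, hP⟩
    rw [← Matrix.SpecialLinearGroup.coe_mul, ← Matrix.SpecialLinearGroup.coe_mul] at hP
    have : A.1 * P = P * B.1 := Subtype.ext hP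
    refine ⟨P⁻¹, ?_⟩
    rw [mul_assoc, inv_inv, this]
    group

theorem exists_similar_of_mul_eq (A : CSMatrix) (P H : Matrix (Fin 3) (Fin 3) ℤ)
    (hP : P.det = 1) (h : A.1.1 * P = P * H) :
    ∃ B : CSMatrix, B.1.1 = H ∧ A.Similar B := by
  have h1 : H.det = 1 := by
    have := congrArg Matrix.det h
    rw [Matrix.det_mul, Matrix.det_mul, hP, A.1.2] at this
    linarith
  have h2 : (H - 1).det = 1 := by
    have : (A.1.1 - 1) * P = P * (H - 1) := by rw [sub_mul, mul_sub, h, one_mul, mul_one]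
    have := congrArg Matrix.det this
    rw [Matrix.det_mul, Matrix.det_mul, hP, A.2] at this
    linarith
  exact ⟨⟨⟨H, h1⟩, h2⟩, rfl, (similar_iff _ _).2 ⟨⟨P, hP⟩, h⟩⟩

theorem Similar.trace_eq {A B : CSMatrix} (h : A.Similar B) : A.trace = B.trace := by
  obtain ⟨P, hP⟩ := h
  have key : ∀ a p : SL(3, ℤ), p⁻¹ * (p * a) = a := fun a p => by group
  rw [trace, trace, hP, Matrix.SpecialLinearGroup.coe_mul, Matrix.trace_mul_comm,
    ← Matrix.SpecialLinearGroup.coe_mul, key]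

/-- The transpose of a Cappell-Shaneson matrix. -/
def transpose (A : CSMatrix) : CSMatrix :=
  ⟨⟨A.1.1.transpose, by rw [Matrix.det_transpose, A.1.2]⟩, by
    change (A.1.1.transpose - 1).det = 1
    have h : (A.1.1 - 1).det = 1 := A.2
    rwa [← Matrix.det_transpose, Matrix.transpose_sub, Matrix.transpose_one] at h⟩

theorem transpose_transpose (A : CSMatrix) : A.transpose.transpose = A := rfl

theorem trace_transpose (A : CSMatrix) : A.transpose.trace = A.trace :=
  Matrix.trace_transpose _

theorem Similar.transpose {A B : CSMatrix} (h : A.Similar B) :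
    A.transpose.Similar B.transpose := by
  obtain ⟨P, hP⟩ := (similar_iff _ _).1 h
  refine Similar.symm ((similar_iff _ _).2 ⟨⟨P.1.transpose, by
    rw [Matrix.det_transpose, P.2]⟩, ?_⟩)
  have := congrArg Matrix.transpose hP
  rw [Matrix.transpose_mul, Matrix.transpose_mul] at this
  exact this.symm

theorem Similar.of_transpose {A B : CSMatrix} (h : A.transpose.Similar B) :
    A.Similar B.transpose := h.transpose

/-- `A` is the upper Hessenberg matrix with rows `(c, x, p)`, `(g, y, q)`, `(0, e, z)`. -/
def IsHess (A : CSMatrix) (c x p g y q e z : ℤ) : Prop :=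
  A.1.1 = !![c, x, p; g, y, q; 0, e, z]

variable {A : CSMatrix} {c x p g y q e z : ℤ}

theorem IsHess.trace_eq (h : A.IsHess c x p g y q e z) : A.trace = c + y + z := by
  change A.1.1.trace = _
  rw [h, Matrix.trace_fin_three]
  simp

theorem IsHess.det_eq (h : A.IsHess c x p g y q e z) :
    c * (y * z - q * e) - x * g * z + p * g * e = 1 := by
  have := A.1.2
  rw [h, Matrix.det_fin_three] at this
  simp at this
  linear_combination this

theorem IsHess.minors_eq (h : A.IsHess c x p g y q e z) :
    c * y - x * g + c * z + y * z - q * e = A.trace - 1 := by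
  have h1 := h.det_eq
  have h2 : (A.1.1 - 1).det = 1 := A.2
  rw [h, Matrix.det_fin_three] at h2
  simp at h2
  rw [h.trace_eq]
  linear_combination h1 - h2

/-- Otherwise `z` would be an eigenvalue dividing the determinant, hence `±1`; but `f_n(1) = -1` and
`f_n(-1) = -2n - 1` is odd. -/
theorem IsHess.e_ne_zero (h : A.IsHess c x p g y q e z) : e ≠ 0 := by
  rintro rfl
  have h1 := h.det_eq
  have h2 := h.minors_eq
  rw [h.trace_eq] at h2
  have h3 : z * (c * y - x * g) = 1 := by linear_combination h1
  rcases Int.eq_one_or_neg_one_of_mul_eq_one h3 with rfl | rfl <;> omega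

theorem IsHess.g_ne_zero (h : A.IsHess c x p g y q e z) : g ≠ 0 := by
  rintro rfl
  have h1 := h.det_eq
  have h2 := h.minors_eq
  rw [h.trace_eq] at h2
  have h3 : c * (y * z - q * e) = 1 := by linear_combination h1
  rcases Int.eq_one_or_neg_one_of_mul_eq_one h3 with rfl | rfl <;> omega

theorem IsHess.neg_e (h : A.IsHess c x p g y q e z) :
    ∃ B, A.Similar B ∧ B.IsHess c x (-p) g y (-q) (-e) z := by
  obtain ⟨B, hB, hs⟩ := exists_similar_of_mul_eq A !![-1, 0, 0; 0, -1, 0; 0, 0, 1]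
    !![c, x, -p; g, y, -q; 0, -e, z] (by simp [Matrix.det_fin_three]) (by
      rw [h]; simp)
  exact ⟨B, hs, hB⟩

/-- Reversing the basis turns the transpose of a Hessenberg matrix into a Hessenberg matrix. -/
theorem IsHess.reverse (h : A.IsHess c x p g y q e z) :
    ∃ B, A.transpose.Similar B ∧ B.IsHess z q p e y x g c := by
  obtain ⟨B, hB, hs⟩ := exists_similar_of_mul_eq A.transpose
    !![0, 0, -1; 0, -1, 0; -1, 0, 0]
    !![z, q, p; e, y, x; 0, g, c] (by simp [Matrix.det_fin_three]) (by
      change A.1.1.transpose * _ = _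
      rw [h]
      ext i j; fin_cases i <;> fin_cases j <;> simp [Matrix.mul_apply, Fin.sum_univ_three])
  exact ⟨B, hs, hB⟩

/-- Replacing the third basis vector `u` by `u + k w`, with `w` the second one. -/
theorem IsHess.shear (h : A.IsHess c x p g y q e z) (k : ℤ) :
    ∃ B, A.Similar B ∧ ∃ p' q',
      B.IsHess c x p' g (y - k * e) q' e (z + k * e) := by
  obtain ⟨B, hB, hs⟩ := exists_similar_of_mul_eq A !![1, 0, 0; 0, 1, k; 0, 0, 1]
    !![c, x, p + k * x; g, y - k * e, q + k * y - k * (z + k * e); 0, e, z + k * e]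
    (by simp [Matrix.det_fin_three]) (by
      rw [h]
      ext i j; fin_cases i <;> fin_cases j <;>
        simp [Matrix.mul_apply, Fin.sum_univ_three] <;> ring)
  exact ⟨B, hs, _, _, hB⟩

/-- The new second basis vector is the primitive vector `(0, μ, ν)`, completed by the Bézout
coefficients `κ`, `l`. The last two conjuncts keep enough of the new entries to follow indices and
residues. -/
theorem exists_isHess_of_first_column (A : CSMatrix) {g μ ν κ l : ℤ} (h1 : A.1.1 1 0 = g * μ)
    (h2 : A.1.1 2 0 = g * ν) (h : κ * μ + l * ν = 1) :
    ∃ B, A.Similar B ∧ ∃ x p y q e z, B.IsHess (A.1.1 0 0) x p g y q e z ∧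
      e = -ν * (A.1.1 1 1 * μ + A.1.1 1 2 * ν) + μ * (A.1.1 2 1 * μ + A.1.1 2 2 * ν) ∧
      A.1.1 2 1 * μ + A.1.1 2 2 * ν = ν * y + κ * e := by
  set m := A.1.1 with hm
  have hP : (!![1, 0, 0; 0, μ, -l; 0, ν, κ] : Matrix (Fin 3) (Fin 3) ℤ).det = 1 := by
    simp [Matrix.det_fin_three]; linear_combination h
  obtain ⟨B, hB, hs⟩ := exists_similar_of_mul_eq A _
    !![m 0 0, m 0 1 * μ + m 0 2 * ν, -m 0 1 * l + m 0 2 * κ;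
      g, κ * (m 1 1 * μ + m 1 2 * ν) + l * (m 2 1 * μ + m 2 2 * ν),
        κ * (-m 1 1 * l + m 1 2 * κ) + l * (-m 2 1 * l + m 2 2 * κ);
      0, -ν * (m 1 1 * μ + m 1 2 * ν) + μ * (m 2 1 * μ + m 2 2 * ν),
        -ν * (-m 1 1 * l + m 1 2 * κ) + μ * (-m 2 1 * l + m 2 2 * κ)] hP (by
      ext i j; fin_cases i <;> fin_cases j <;>
        simp [Matrix.mul_apply, Fin.sum_univ_three, ← hm]
      · linear_combination h1
      · linear_combination (-(m 1 1 * μ + m 1 2 * ν)) * h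
      · linear_combination (-(-m 1 1 * l + m 1 2 * κ)) * h
      · linear_combination h2
      · linear_combination (-(m 2 1 * μ + m 2 2 * ν)) * h
      · linear_combination (-(-m 2 1 * l + m 2 2 * κ)) * h)
  refine ⟨B, hs, _, _, _, _, _, _, hB, rfl, ?_⟩
  linear_combination (-(m 2 1 * μ + m 2 2 * ν)) * h

theorem exists_isHess (A : CSMatrix) :
    ∃ B, A.Similar B ∧ ∃ c x p g y q e z, B.IsHess c x p g y q e z := by
  by_cases h0 : Int.gcd (A.1.1 1 0) (A.1.1 2 0) = 0
  · rw [Int.gcd_eq_zero_iff] at h0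
    have h1 := A.1.2
    have h2 : (A.1.1 - 1).det = 1 := A.2
    rw [Matrix.det_fin_three] at h1 h2
    simp [h0.1, h0.2] at h1 h2
    have h3 : A.1.1 0 0 * (A.1.1 1 1 * A.1.1 2 2 - A.1.1 1 2 * A.1.1 2 1) = 1 := by
      linear_combination h1
    rcases Int.eq_one_or_neg_one_of_mul_eq_one h3 with h4 | h4
    · rw [h4] at h2
      simp at h2
    · rw [h4] at h2
      ring_nf at h2
      omega
  · obtain ⟨μ, ν, hc, h1, h2⟩ := Int.exists_gcd_one (Nat.pos_of_ne_zero h0)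
    obtain ⟨κ, l, hk⟩ := (Int.isCoprime_iff_gcd_eq_one (m := μ) (n := ν)).2 hc
    obtain ⟨B, hs, x, p, y, q, e, z, hB, -⟩ := A.exists_isHess_of_first_column
      (h1.trans (mul_comm _ _)) (h2.trans (mul_comm _ _)) hk
    exact ⟨B, hs, _, _, _, _, _, _, _, _, hB⟩

end CSMatrix

end CappellShaneson

/-! ### Changing the cyclic vector, and minimal Hessenberg sizes -/

namespace CappellShaneson

namespace CSMatrix

variable {A : CSMatrix} {c x p g y q e z : ℤ}

/-- A primitive vector `(s, t, 0)` in the plane of the first two basis vectors of a Hessenberg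
matrix can be made the first basis vector of another one. -/
theorem IsHess.plane (h : A.IsHess c x p g y q e z) {s t : ℤ} (hst : IsCoprime s t) :
    ∃ B, A.Similar B ∧ ∃ c' x' p' y' q' e' z', ∃ g' : ℕ,
      B.IsHess c' x' p' g' y' q' e' z' ∧ 0 < e' ∧
      g' = Int.gcd (g * s ^ 2 + (y - c) * s * t - x * t ^ 2) (e * t) ∧
      |g| * (g' ^ 2 * e') = |e * form A.trace (c * t - g * s) t| ∧
      g' * e' ∣ e * (z' * t - (c * t - g * s)) := by
  obtain ⟨b, a, hab⟩ := hst
  set Q := g * s ^ 2 + (y - c) * s * t - x * t ^ 2 with hQ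
  have hgcd : Int.gcd Q (e * t) ≠ 0 := by
    intro h0
    rw [Int.gcd_eq_zero_iff] at h0
    have ht : t = 0 := (mul_eq_zero.1 h0.2).resolve_left h.e_ne_zero
    have hs : s = 0 := by
      have h1 := h0.1
      rw [hQ, ht] at h1
      simpa [h.g_ne_zero] using h1
    rw [ht, hs] at hab
    simp at hab
  obtain ⟨C, hC, hAC⟩ := exists_similar_of_mul_eq A !![s, -a, 0; t, b, 0; 0, 0, 1]
    !![b * (c * s + x * t) + a * (g * s + y * t), b * (-c * a + x * b) + a * (-g * a + y * b),
        b * p + a * q;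
      Q, -t * (-c * a + x * b) + s * (-g * a + y * b), -t * p + s * q;
      e * t, e * b, z]
    (by simp [Matrix.det_fin_three]; linear_combination hab) (by
      rw [h]
      ext i j; fin_cases i <;> fin_cases j <;>
        simp [Matrix.mul_apply, Fin.sum_univ_three]
      · rw [hQ]; linear_combination (-(c * s + x * t)) * hab
      · linear_combination (-(-c * a + x * b)) * hab
      · linear_combination (-p) * hab
      · rw [hQ]; linear_combination (-(g * s + y * t)) * hab
      · linear_combination (-(-g * a + y * b)) * hab
      · linear_combination (-q) * hab)
  obtain ⟨μ, ν, hc, h1, h2⟩ := Int.exists_gcd_one (Nat.pos_of_ne_zero hgcd)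
  obtain ⟨κ, l, hk⟩ := (Int.isCoprime_iff_gcd_eq_one (m := μ) (n := ν)).2 hc
  set g' := Int.gcd Q (e * t) with hg'
  obtain ⟨B, hCB, x', p', y', q', e', z', hB, he', hz'⟩ :=
    C.exists_isHess_of_first_column (g := g') (μ := μ) (ν := ν)
      (by rw [hC]; simp; linarith) (by rw [hC]; simp; linarith) hk
  have hAB := hAC.trans hCB
  have hn : A.trace = C.1.1 0 0 + y' + z' := by rw [hAB.trace_eq, hB.trace_eq]
  have hn' := h.trace_eq
  rw [hC] at he' hz' hn
  simp at he' hz' hn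
  -- The index of the cyclic lattice of the new first vector, up to sign; the characteristic
  -- polynomial enters through `minors_eq` and `det_eq`.
  have hF : g * (g' ^ 2 * e') = -(e * form A.trace (c * t - g * s) t) := by
    have e1 : (g' : ℤ) ^ 2 * e' = Q ^ 2 * (e * b) + Q * (e * t) *
        (z - (-(t * (-(c * a) + x * b)) + s * (-(g * a) + y * b))) -
        (e * t) ^ 2 * (-(t * p) + s * q) := by
      rw [he', h1, h2]; ring
    have e2 : (g' : ℤ) ^ 2 * e' = e * (Q * (g * s - c * t) + Q * t * z -
        e * t ^ 2 * (-(t * p) + s * q)) := by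
      rw [e1, hQ]
      linear_combination e * (g * s ^ 2 + (y - c) * s * t - x * t ^ 2) * (g * s - c * t) * hab
    have h3 := h.det_eq
    have h4 := h.minors_eq
    rw [e2, form, hQ]
    rw [hn'] at h4 ⊢
    linear_combination (-(e * (c * t - g * s) * t ^ 2)) * h4 + e * t ^ 3 * h3
  -- This determines the residue of the new lattice: for `e = g' = 1` it reads `z' * Y ≡ X` modulo
  -- the new entry.
  have hdvd : g' * e' ∣ e * (z' * t - (c * t - g * s)) := by
    refine ⟨κ, ?_⟩
    have e1 : e * b * Q + z * (e * t) = e * t * y' + κ * e' * g' := by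
      calc e * b * Q + z * (e * t) = e * b * (μ * g') + z * (ν * g') := by rw [← h1, ← h2]
        _ = (e * b * μ + z * ν) * g' := by ring
        _ = (ν * y' + κ * e') * g' := by rw [hz']
        _ = ν * g' * y' + κ * e' * g' := by ring
        _ = _ := by rw [← h2]
    have e2 : y' = c + y + z - (b * (c * s + x * t) + a * (g * s + y * t)) - z' := by
      linarith
    rw [e2, hQ] at e1
    linear_combination e1 - e * (g * s + y * t) * hab
  have hF' : |g| * ((g' : ℤ) ^ 2 * |e'|) = |e * form A.trace (c * t - g * s) t| := by
    rw [← abs_neg (e * _), ← hF, abs_mul, abs_mul, abs_of_nonneg (sq_nonneg (g' : ℤ))]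
  rcases lt_or_gt_of_ne hB.e_ne_zero with he | he
  · obtain ⟨B', hBB, hB'⟩ := hB.neg_e
    refine ⟨B', hAB.trans hBB, _, _, _, _, _, _, _, _, hB', by linarith, rfl, ?_, ?_⟩
    · rw [← hF', abs_of_neg he]
    · rw [mul_neg]; exact (neg_dvd).2 hdvd
  · exact ⟨B, hAB, _, _, _, _, _, _, _, _, hB, he, rfl, by rw [← hF', abs_of_pos he], hdvd⟩

/-- A Hessenberg matrix with `g = 1` is similar to a standard one. -/
theorem IsHess.exists_X (h : A.IsHess c x p 1 y q e z) :
    ∃ t : CSTriple, t.c = z ∧ t.d = e ∧ t.n = A.trace ∧ A.Similar t.X := by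
  have h1 := h.det_eq
  have h2 := h.minors_eq
  have h3 := h.trace_eq
  obtain ⟨B, hB, hs⟩ := exists_similar_of_mul_eq A !![-1, q, -c; 0, 0, -1; 0, -1, 0]
    (CSTriple.mat (z * q + p - q * c) (e * q + x - c * y) z e A.trace)
    (by simp [Matrix.det_fin_three]) (by
      rw [h, h3, CSTriple.mat]
      ext i j; fin_cases i <;> fin_cases j <;>
        simp [Matrix.mul_apply, Fin.sum_univ_three] <;> ring)
  have hdvd : e ∣ f A.trace z := by
    refine ⟨-(z * q + p - q * c), ?_⟩
    rw [h3] at h2 ⊢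
    rw [f]
    linear_combination h1 - z * h2
  refine ⟨⟨z, e, A.trace, h.e_ne_zero, hdvd⟩, rfl, rfl, rfl, ?_⟩
  have hab := CSTriple.eq_a_and_eq_b ⟨z, e, A.trace, h.e_ne_zero, hdvd⟩
    (a' := z * q + p - q * c) (b' := e * q + x - c * y) (hB ▸ B.1.2) (hB ▸ B.2)
  convert hs using 1
  apply Subtype.ext
  apply Subtype.ext
  rw [hB, hab.1, hab.2]
  rfl

theorem isHess_X (t : CSTriple) :
    ∃ B, t.X.Similar B ∧ B.IsHess 0 t.b t.a 1 (t.n - t.c) 0 t.d t.c := by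
  obtain ⟨B, hB, hs⟩ := exists_similar_of_mul_eq t.X !![-1, 0, 0; 0, 0, -1; 0, -1, 0]
    !![0, t.b, t.a; 1, t.n - t.c, 0; 0, t.d, t.c]
    (by simp [Matrix.det_fin_three]) (by
      change CSTriple.mat t.a t.b t.c t.d t.n * _ = _
      rw [CSTriple.mat]
      ext i j; fin_cases i <;> fin_cases j <;>
        simp [Matrix.mul_apply, Fin.sum_univ_three])
  exact ⟨B, hs, hB⟩

theorem trace_X (t : CSTriple) : t.X.trace = t.n := by
  change (CSTriple.mat t.a t.b t.c t.d t.n).trace = _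
  rw [Matrix.trace_fin_three]
  simp [CSTriple.mat]

theorem X_similar_of_modEq {s t : CSTriple} (hn : s.n = t.n) (hd : s.d = t.d)
    (hc : s.c ≡ t.c [ZMOD s.d]) : s.X.Similar t.X := by
  obtain ⟨k, hk⟩ := hc.dvd
  obtain ⟨B, hs, hB⟩ := isHess_X s
  obtain ⟨C, hBC, p', q', hC⟩ := hB.shear k
  obtain ⟨u, hu1, hu2, hu3, hCu⟩ := hC.exists_X
  have : u = t := by
    ext
    · rw [hu1]; linarith
    · rw [hu2, hd]
    · rw [hu3, ← hBC.trace_eq, ← hs.trace_eq, trace_X, hn]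
  exact this ▸ (hs.trans hBC).trans hCu

theorem X_similar_of_neg {s t : CSTriple} (hn : s.n = t.n) (hd : s.d = -t.d)
    (hc : s.c = t.c) : s.X.Similar t.X := by
  obtain ⟨B, hs, hB⟩ := isHess_X s
  obtain ⟨C, hBC, hC⟩ := hB.neg_e
  obtain ⟨u, hu1, hu2, hu3, hCu⟩ := hC.exists_X
  have : u = t := by
    ext
    · rw [hu1, hc]
    · rw [hu2, hd, neg_neg]
    · rw [hu3, ← hBC.trace_eq, ← hs.trace_eq, trace_X, hn]
  exact this ▸ (hs.trans hBC).trans hCu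

/-- The principal ideal step: if `(X, Y)` is a primitive vector with `X ≡ c Y mod d` and
`|f_n(X, Y)| = d D`, then the transpose of `X_{c,d,n}` is similar to `X_{C,D,n}` with
`C Y ≡ X mod D`. -/
theorem exists_similar_transpose_X (t : CSTriple) (hd : 0 < t.d) {X Y D : ℤ}
    (hXY : IsCoprime X Y) (hmem : t.d ∣ X - t.c * Y) (hD : |form t.n X Y| = t.d * D) :
    ∃ u : CSTriple, u.n = t.n ∧ u.d = D ∧ u.c * Y ≡ X [ZMOD D] ∧
      t.X.transpose.Similar u.X := by
  obtain ⟨B, hs, hB⟩ := isHess_X t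
  -- The reversed transpose has subdiagonal `(d, 1)`, so the vectors of its plane correspond to the
  -- lattice `X ≡ c Y mod d`.
  obtain ⟨C, hBC, hC⟩ := hB.reverse
  obtain ⟨k, hk⟩ := hmem
  have hX : X = t.c * Y - t.d * (-k) := by linarith
  have hdkY : IsCoprime (t.d * k) Y := by
    rw [← hk, sub_eq_add_neg, ← neg_mul]
    exact hXY.add_mul_right_left _
  have hdY : IsCoprime t.d Y := hdkY.of_mul_left_left
  have hkY : IsCoprime (-k) Y := hdkY.of_mul_left_right.neg_left
  have htr : C.trace = t.n := by
    rw [← hBC.trace_eq, trace_transpose, ← hs.trace_eq, trace_X]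
  obtain ⟨E, hCE, c', x', p', y', q', e', z', g', hE, he', hg', hF, hdvd⟩ := hC.plane hkY
  have hg1 : g' = 1 := by
    rw [hg', ← Int.isCoprime_iff_gcd_eq_one]
    rw [one_mul, zero_mul, sub_zero]
    exact (hdY.mul_left (hkY.pow_left (m := 2))).add_mul_right_left _
  subst hg1
  rw [htr, ← hX] at hF
  have heD : e' = D := by
    have : t.d * e' = t.d * D := by
      rw [← hD]
      simpa [abs_of_pos hd] using hF
    exact mul_left_cancel₀ hd.ne' this
  obtain ⟨u, hu1, hu2, hu3, hEu⟩ := (by simpa using hE : E.IsHess c' x' p' 1 y' q' e' z').exists_X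
  refine ⟨u, ?_, hu2.trans heD, ?_, (hs.transpose.trans hBC).trans (hCE.trans hEu)⟩
  · rw [hu3, ← hCE.trace_eq, htr]
  · rw [hu1]
    refine (Int.modEq_iff_dvd.2 ?_).symm
    rw [← heD]
    rw [← hX] at hdvd
    simpa using hdvd

/-- The sizes `g ^ 2 e` of the Hessenberg matrices similar to `A`. -/
def IsHessNorm (A : CSMatrix) (N : ℕ) : Prop :=
  ∃ B, A.Similar B ∧ ∃ c x p g y q e z, B.IsHess c x p g y q e z ∧ 0 < g ∧ 0 < e ∧
    (N : ℤ) = g ^ 2 * e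

theorem exists_isHess_pos (A : CSMatrix) : ∃ N, A.IsHessNorm N := by
  obtain ⟨B, hs, c, x, p, g, y, q, e, z, hB⟩ := A.exists_isHess
  obtain ⟨C, hBC, c', x', p', y', q', e', z', g', hC, he', -⟩ := hB.plane isCoprime_one_left
    (t := 0)
  have hg : 0 < (g' : ℤ) := lt_of_le_of_ne (by positivity) (Ne.symm hC.g_ne_zero)
  exact ⟨(g' ^ 2 * e').toNat, C, hs.trans hBC, _, _, _, _, _, _, _, _, hC, hg, he',
    Int.toNat_of_nonneg (by positivity)⟩

/-- Any nonzero lattice vector bounds the minimal Hessenberg size. -/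
theorem IsHess.exists_norm_le (h : A.IsHess c x p g y q e z) (hg : 0 < g) (he : 0 < e)
    {X Y : ℤ} (hXY : X ≠ 0 ∨ Y ≠ 0) (hmem : g ∣ X - c * Y) :
    ∃ N, A.IsHessNorm N ∧ g * N ≤ e * |form A.trace X Y| := by
  obtain ⟨k, hk⟩ := hmem
  have hkY : 0 < Int.gcd (-k) Y := by
    rw [Nat.pos_iff_ne_zero, Ne, Int.gcd_eq_zero_iff]
    rintro ⟨h1, h2⟩
    have h3 : k = 0 := by linarith
    rw [h3, h2] at hk
    simp at hk
    exact hXY.elim (fun h => h hk) (fun h => h h2)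
  obtain ⟨s, t, hst, h1, h2⟩ := Int.exists_gcd_one hkY
  set r := Int.gcd (-k) Y
  obtain ⟨B, hs, c', x', p', y', q', e', z', g', hB, he', -, hF, -⟩ :=
    h.plane (Int.isCoprime_iff_gcd_eq_one.2 hst)
  have hg' : 0 < (g' : ℤ) := lt_of_le_of_ne (by positivity) (Ne.symm hB.g_ne_zero)
  refine ⟨(g' ^ 2 * e').toNat, ⟨B, hs, _, _, _, _, _, _, _, _, hB, hg', he',
    Int.toNat_of_nonneg (by positivity)⟩, ?_⟩
  rw [Int.toNat_of_nonneg (by positivity)]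
  rw [abs_of_pos hg, abs_mul, abs_of_pos he] at hF
  rw [hF]
  refine mul_le_mul_of_nonneg_left ?_ he.le
  have hX : X = r * (c * t - g * s) := by linear_combination hk + c * h2 - g * h1
  have : form A.trace X Y = r ^ 3 * form A.trace (c * t - g * s) t := by
    rw [hX, h2, form, form]; ring
  rw [this, abs_mul]
  have hr : (1 : ℤ) ≤ |(r : ℤ) ^ 3| := by
    rw [abs_of_nonneg (by positivity)]
    exact one_le_pow₀ (by exact_mod_cast hkY)
  nlinarith [abs_nonneg (form A.trace (c * t - g * s) t)]

/-- `A` has a Hessenberg form of minimal size; its entry `g` is small. -/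
theorem exists_minimal_isHess (A : CSMatrix) (hA : 3 ≤ A.trace) :
    ∃ B, A.Similar B ∧ ∃ c x p g y q e z, B.IsHess c x p g y q e z ∧ 0 < g ∧ 0 < e ∧
      (∀ N, A.IsHessNorm N → g ^ 2 * e ≤ N) ∧
      (∀ X Y, (X ≠ 0 ∨ Y ≠ 0) → g ∣ X - c * Y → g ^ 3 ≤ |form A.trace X Y|) ∧
      27 * g ^ 3 ≤ 4 * (A.trace + 2) ^ 2 ∧
      ∃ N, A.transpose.IsHessNorm N ∧ 27 * (N : ℤ) ^ 2 ≤ 4 * (A.trace + 2) ^ 2 * (g ^ 2 * e) := by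
  classical
  obtain ⟨B, hs, c, x, p, g, y, q, e, z, hB, hg, he, hN⟩ := Nat.find_spec A.exists_isHess_pos
  have hmin : ∀ N, A.IsHessNorm N → g ^ 2 * e ≤ N := fun N h => by
    rw [← hN]; exact_mod_cast Nat.find_min' _ h
  -- A lattice vector of smaller norm would yield a cyclic lattice of index below `g ^ 2 * e`.
  have hcube : ∀ X Y, (X ≠ 0 ∨ Y ≠ 0) → g ∣ X - c * Y → g ^ 3 ≤ |form A.trace X Y| := by
    intro X Y hXY hmem
    obtain ⟨N, ⟨C, hC⟩, hle⟩ := hB.exists_norm_le hg he hXY hmem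
    have h1 := hmin N ⟨C, hs.trans hC.1, hC.2⟩
    rw [← hs.trace_eq] at hle
    refine le_of_mul_le_mul_left (a := e) ?_ he
    calc e * g ^ 3 = g * (g ^ 2 * e) := by ring
      _ ≤ g * N := mul_le_mul_of_nonneg_left h1 hg.le
      _ ≤ _ := hle
  refine ⟨B, hs, c, x, p, g, y, q, e, z, hB, hg, he, hmin, hcube, ?_, ?_⟩
  · obtain ⟨X, Y, hXY, hmem, hle⟩ := exists_hexForm_le hg c
    have h1 := hcube X Y hXY hmem
    have h2 := form_sq_le hA X Y
    have h3 : hexForm X Y ^ 3 ≤ g ^ 3 := pow_le_pow_left₀ (hexForm_nonneg X Y) hle 3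
    have h4 : (g ^ 3) ^ 2 ≤ form A.trace X Y ^ 2 := by
      rw [← sq_abs (form _ _ _)]
      exact pow_le_pow_left₀ (by positivity) h1 2
    have h5 : 4 * (A.trace + 2) ^ 2 * hexForm X Y ^ 3 ≤ 4 * (A.trace + 2) ^ 2 * g ^ 3 :=
      mul_le_mul_of_nonneg_left h3 (by positivity)
    have h6 : 0 < g ^ 3 := by positivity
    refine le_of_mul_le_mul_left (a := g ^ 3) ?_ h6
    nlinarith
  -- In the dual plane the roles of `g` and `e` are exchanged, so a short vector modulo `e` gives a
  -- size for the transpose of order at most `g √e`, the square root of `g ^ 2 * e`.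
  · obtain ⟨C, hBC, hC⟩ := hB.reverse
    obtain ⟨X, Y, hXY, hmem, hle⟩ := exists_hexForm_le he z
    obtain ⟨N, ⟨D, hD⟩, hN'⟩ := hC.exists_norm_le he hg hXY hmem
    have htr : C.trace = A.trace := by rw [← hBC.trace_eq, trace_transpose, hs.trace_eq]
    rw [htr] at hN'
    refine ⟨N, ⟨D, (hs.transpose.trans hBC).trans hD.1, hD.2⟩, ?_⟩
    have h2 := form_sq_le hA X Y
    have h3 : hexForm X Y ^ 3 ≤ e ^ 3 := pow_le_pow_left₀ (hexForm_nonneg X Y) hle 3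
    have h4 : (e * N) ^ 2 ≤ (g * |form A.trace X Y|) ^ 2 :=
      pow_le_pow_left₀ (by positivity) hN' 2
    rw [mul_pow g, sq_abs] at h4
    have h5 : 4 * (A.trace + 2) ^ 2 * hexForm X Y ^ 3 ≤ 4 * (A.trace + 2) ^ 2 * e ^ 3 :=
      mul_le_mul_of_nonneg_left h3 (by positivity)
    have h6 : 0 < e ^ 2 := by positivity
    refine le_of_mul_le_mul_left (a := e ^ 2) ?_ h6
    have h7 : g ^ 2 * (27 * form A.trace X Y ^ 2) ≤ g ^ 2 * (4 * (A.trace + 2) ^ 2 * e ^ 3) :=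
      mul_le_mul_of_nonneg_left (h2.trans h5) (by positivity)
    nlinarith

/-- The minimal Hessenberg size of a matrix with a nonnegative trace is `O(n ^ 2)`. -/
theorem exists_small_isHess (A : CSMatrix) (hA : 3 ≤ A.trace) :
    ∃ B, A.Similar B ∧ ∃ c x p g y q e z, B.IsHess c x p g y q e z ∧ 0 < g ∧ 0 < e ∧
      (∀ X Y, (X ≠ 0 ∨ Y ≠ 0) → g ∣ X - c * Y → g ^ 3 ≤ |form A.trace X Y|) ∧
      27 * g ^ 3 ≤ 4 * (A.trace + 2) ^ 2 ∧ 27 * (g ^ 2 * e) ≤ 4 * (A.trace + 2) ^ 2 := by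
  obtain ⟨B, hs, c, x, p, g, y, q, e, z, hB, hg, he, hmin, hcube, hg3, N, hN, hN'⟩ :=
    A.exists_minimal_isHess hA
  obtain ⟨-, -, -, -, -, g₂, -, -, e₂, -, -, hg₂, he₂, hmin₂, -, -, N₂, hN₂, hN₂'⟩ :=
    A.transpose.exists_minimal_isHess (by rwa [trace_transpose])
  rw [trace_transpose] at hN₂'
  rw [transpose_transpose] at hN₂
  refine ⟨B, hs, c, x, p, g, y, q, e, z, hB, hg, he, hcube, hg3, ?_⟩
  have h1 := hmin N₂ hN₂
  have h2 := hmin₂ N hN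
  obtain ⟨a, ha⟩ : ∃ a, a = g ^ 2 * e := ⟨_, rfl⟩
  obtain ⟨b, hb⟩ : ∃ b, b = g₂ ^ 2 * e₂ := ⟨_, rfl⟩
  obtain ⟨K, hK⟩ : ∃ K, K = 4 * (A.trace + 2) ^ 2 := ⟨_, rfl⟩
  have hK0 : 0 ≤ K := by rw [hK]; positivity
  have ha0 : 0 < a := by rw [ha]; positivity
  have hb0 : 0 < b := by rw [hb]; positivity
  rw [← ha] at h1 hN' ⊢
  rw [← hb] at h2 hN₂'
  rw [← hK] at hN' hN₂' ⊢
  have h3 : 27 * b ^ 2 ≤ K * a := by nlinarith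
  have h4 : 27 * a ^ 2 ≤ K * b := by nlinarith
  -- From `27 b ^ 2 ≤ K a` and `27 a ^ 2 ≤ K b`, the larger of `a`, `b` is at most `K / 27`.
  rcases le_total a b with h | h
  · refine le_of_mul_le_mul_right (a := b) ?_ hb0
    nlinarith
  · refine le_of_mul_le_mul_right (a := a) ?_ ha0
    nlinarith

end CSMatrix

end CappellShaneson

/-! ### Cyclic vectors in the dual plane -/

namespace CappellShaneson

namespace CSMatrix

variable {A : CSMatrix} {c x p g y q e z : ℤ}

theorem IsHess.g_dvd (h : A.IsHess c x p g y q e z) : g ∣ f A.trace c := by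
  have h1 := h.det_eq
  have h2 := h.minors_eq
  have h3 := h.trace_eq
  refine ⟨-x * c + x * z - p * e, ?_⟩
  rw [h3] at h2 ⊢
  rw [f]
  linear_combination h1 - c * h2

theorem IsHess.e_dvd (h : A.IsHess c x p g y q e z) : e ∣ f A.trace z := by
  have h1 := h.det_eq
  have h2 := h.minors_eq
  have h3 := h.trace_eq
  refine ⟨-q * z + c * q - p * g, ?_⟩
  rw [h3] at h2 ⊢
  rw [f]
  linear_combination h1 - z * h2

/-- A criterion for a vector in the dual plane of a Hessenberg matrix to be cyclic. -/
theorem IsHess.exists_transpose_similar_X (h : A.IsHess c x p g y q e z) (hg : 0 < g)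
    (he : 0 < e) {X Y D : ℤ} (hXY : IsCoprime X Y) (hmem : e ∣ X - z * Y)
    (hG : IsCoprime (X ^ 2 - (A.trace - c) * X * Y + (A.trace - 1 - c * (A.trace - c)) * Y ^ 2) g)
    (hD : g * |form A.trace X Y| = e * D) :
    ∃ u : CSTriple, u.n = A.trace ∧ u.d = D ∧ A.transpose.Similar u.X := by
  obtain ⟨C, hAC, hC⟩ := h.reverse
  obtain ⟨k, hk⟩ := hmem
  have hX : X = z * Y - e * (-k) := by linarith
  have hekY : IsCoprime (e * k) Y := by
    rw [← hk, sub_eq_add_neg, ← neg_mul]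
    exact hXY.add_mul_right_left _
  have heY : IsCoprime e Y := hekY.of_mul_left_left
  have hkY : IsCoprime (-k) Y := hekY.of_mul_left_right.neg_left
  have htr : C.trace = A.trace := by rw [← hAC.trace_eq, trace_transpose]
  obtain ⟨E, hCE, c', x', p', y', q', e', z', g', hE, he', hg', hF, -⟩ := hC.plane hkY
  have hg1 : g' = 1 := by
    rw [hg', ← Int.isCoprime_iff_gcd_eq_one]
    refine IsCoprime.mul_right ?_ ?_
    · have h2 := h.minors_eq
      have h3 := h.trace_eq
      -- The quadratic form in `hG` is the homogenized quotient of `f_n(x)` by `x - c` modulo `g`;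
      -- on lattice vectors it is congruent to `e` times the subdiagonal entry whose gcd with `g *
      -- Y` is `g'`.
      have h4 : IsCoprime (e * (e * (-k) ^ 2 + (y - z) * (-k) * Y - q * Y ^ 2)) g := by
        have heq : e * (e * (-k) ^ 2 + (y - z) * (-k) * Y - q * Y ^ 2) =
            X ^ 2 - (A.trace - c) * X * Y + (A.trace - 1 - c * (A.trace - c)) * Y ^ 2 +
              x * Y ^ 2 * g := by
          rw [hX]
          rw [h3] at h2 ⊢
          linear_combination Y ^ 2 * h2
        rw [heq]
        exact hG.add_mul_right_left _
      exact h4.of_mul_left_right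
    · have heq : e * (-k) ^ 2 + (y - z) * (-k) * Y - q * Y ^ 2 =
          e * (-k) ^ 2 + ((y - z) * (-k) - q * Y) * Y := by ring
      rw [heq]
      exact (heY.mul_left (hkY.pow_left (m := 2))).add_mul_right_left _
  subst hg1
  rw [htr, ← hX] at hF
  have heD : e' = D := by
    have : e * e' = e * D := by
      rw [← hD]
      simpa [abs_of_pos hg, abs_of_pos he, abs_mul] using hF
    exact mul_left_cancel₀ he.ne' this
  obtain ⟨u, hu1, hu2, hu3, hEu⟩ := (by simpa using hE : E.IsHess c' x' p' 1 y' q' e' z').exists_X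
  refine ⟨u, ?_, hu2.trans heD, hAC.trans (hCE.trans hEu)⟩
  rw [hu3, ← hCE.trace_eq, htr]

/-! ### The symmetry `n ↦ 5 - n` -/

theorem minors_eq (A : CSMatrix) :
    A.1.1 0 0 * A.1.1 1 1 - A.1.1 0 1 * A.1.1 1 0 + A.1.1 0 0 * A.1.1 2 2 -
      A.1.1 0 2 * A.1.1 2 0 + A.1.1 1 1 * A.1.1 2 2 - A.1.1 1 2 * A.1.1 2 1 = A.trace - 1 := by
  have h1 := A.1.2
  have h2 : (A.1.1 - 1).det = 1 := A.2
  change _ = A.1.1.trace - 1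
  rw [Matrix.det_fin_three] at h1 h2
  rw [Matrix.trace_fin_three]
  simp at h2
  linear_combination h1 - h2

/-- The matrix `A (A - 1)⁻¹`, whose trace is `5 - tr A`. -/
def flip (A : CSMatrix) : CSMatrix :=
  have h : (A.1.1 - 1).det = 1 := A.2
  have h' : (A.1.1 - 1).adjugate * (A.1.1 - 1) = 1 := by
    rw [Matrix.adjugate_mul, h, one_smul]
  ⟨⟨1 + (A.1.1 - 1).adjugate, by
      have h1 : (1 + (A.1.1 - 1).adjugate) * (A.1.1 - 1) = A.1.1 := by
        rw [add_mul, h', one_mul, sub_add_cancel]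
      have := congrArg Matrix.det h1
      rwa [Matrix.det_mul, h, mul_one, A.1.2] at this⟩, by
    change (1 + (A.1.1 - 1).adjugate - 1).det = 1
    rw [add_sub_cancel_left]
    have := congrArg Matrix.det h'
    rwa [Matrix.det_mul, h, mul_one, Matrix.det_one] at this⟩

theorem flip_val (A : CSMatrix) : A.flip.1.1 = 1 + (A.1.1 - 1).adjugate := rfl

theorem adjugate_sub_one_mul (A : CSMatrix) : (A.1.1 - 1).adjugate * (A.1.1 - 1) = 1 := by
  have h : (A.1.1 - 1).det = 1 := A.2
  rw [Matrix.adjugate_mul, h, one_smul]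

theorem mul_adjugate_sub_one (A : CSMatrix) : (A.1.1 - 1) * (A.1.1 - 1).adjugate = 1 := by
  have h : (A.1.1 - 1).det = 1 := A.2
  rw [Matrix.mul_adjugate, h, one_smul]

theorem flip_flip (A : CSMatrix) : A.flip.flip = A := by
  apply Subtype.ext
  apply Subtype.ext
  have h1 := A.flip.adjugate_sub_one_mul
  rw [flip_val] at h1
  rw [flip_val, flip_val]
  rw [add_sub_cancel_left] at h1 ⊢
  have h2 := congrArg (· * (A.1.1 - 1)) h1
  simp only [mul_assoc, A.adjugate_sub_one_mul, mul_one, one_mul] at h2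
  rw [h2]
  exact add_sub_cancel _ _

theorem trace_flip (A : CSMatrix) : A.flip.trace = 5 - A.trace := by
  have h := A.minors_eq
  change A.flip.1.1.trace = 5 - A.1.1.trace
  change _ = A.1.1.trace - 1 at h
  rw [flip_val, Matrix.adjugate_fin_three, Matrix.trace_fin_three]
  rw [Matrix.trace_fin_three] at h ⊢
  simp
  linear_combination h

theorem Similar.flip {A B : CSMatrix} (h : A.Similar B) : A.flip.Similar B.flip := by
  obtain ⟨P, hP⟩ := (similar_iff _ _).1 h
  refine (similar_iff _ _).2 ⟨P, ?_⟩
  rw [flip_val, flip_val, add_mul, mul_add, one_mul, mul_one]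
  congr 1
  have h1 : (A.1.1 - 1) * P.1 = P.1 * (B.1.1 - 1) := by
    rw [sub_mul, mul_sub, one_mul, mul_one]
    exact congrArg (· - P.1) hP
  calc (A.1.1 - 1).adjugate * P.1
      = (A.1.1 - 1).adjugate * (P.1 * (B.1.1 - 1)) * (B.1.1 - 1).adjugate := by
        rw [mul_assoc, mul_assoc, mul_adjugate_sub_one, mul_one]
    _ = P.1 * (B.1.1 - 1).adjugate := by
        rw [← h1, ← mul_assoc, adjugate_sub_one_mul, one_mul]

theorem exists_flip_X (t : CSTriple) : ∃ u : CSTriple, u.n = 5 - t.n ∧ u.d = -t.d ∧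
    u.c = t.c ^ 2 + (1 - t.n) * t.c + 1 ∧ t.X.flip.Similar u.X := by
  obtain ⟨B, hs, hB⟩ := isHess_X t
  have had := t.a_mul_d
  rw [f] at had
  have hb : t.b = (t.c - 1) * (t.n - t.c - 1) := rfl
  have hm : B.flip.1.1 = !![t.b + 1, -(t.b * (t.c - 1) - t.a * t.d), -t.a * (t.n - t.c - 1);
      1 - t.c, 2 - t.c, t.a; t.d, t.d, 1 - t.c * (t.n - t.c - 1)] := by
    rw [flip_val, hB, Matrix.adjugate_fin_three]
    ext i j; fin_cases i <;> fin_cases j <;> simp <;> (try rw [hb]) <;> ring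
  obtain ⟨C, hBC, x, p, y, q, e, z, hC, he, hy⟩ := B.flip.exists_isHess_of_first_column
    -- The Bézout relation is `f_n(c) = c (c - 1) (c + 1 - n) - 1` combined with `a d = -f_n(c)`.
    (g := 1) (μ := 1 - t.c) (ν := t.d) (κ := -t.c * (t.c + 1 - t.n)) (l := t.a)
    (by rw [hm]; simp) (by rw [hm]; simp) (by linear_combination had)
  rw [hm] at he hy hC
  simp at he hy hC
  have he' : e = -t.d := by
    rw [he]; linear_combination -t.d * had
  have hy' : y = 2 - t.c := by
    refine mul_left_cancel₀ t.d_ne_zero ?_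
    rw [he'] at hy
    linear_combination -hy
  obtain ⟨u, hu1, hu2, hu3, hCu⟩ := hC.exists_X
  have htr : C.trace = 5 - t.n := by
    rw [← hBC.trace_eq, trace_flip, ← hs.trace_eq, trace_X]
  refine ⟨u, hu3.trans htr, hu2.trans he', ?_, (hs.flip.trans hBC).trans hCu⟩
  have := hC.trace_eq
  rw [htr, hy', hb] at this
  rw [hu1]
  linear_combination -this

theorem gompfEquiv_of_similar {A B : CSMatrix} (h : A.Similar B) : A.GompfEquiv B :=
  .rel _ _ (Or.inl h)

theorem gompfEquiv_shift (t : CSTriple) (k : ℤ) : t.X.GompfEquiv (t.shift k).X :=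
  .rel _ _ (Or.inr ⟨t, k, rfl, rfl⟩)

theorem GompfEquiv.trans {A B C : CSMatrix} (h : A.GompfEquiv B) (h' : B.GompfEquiv C) :
    A.GompfEquiv C := Relation.EqvGen.trans _ _ _ h h'

/-- The flip turns `(n, d)` into `(5 - n, -d)`, so a shift by `k d` becomes a shift by `k (-d)`; the
new parameter `c` changes only by a multiple of `d`. -/
theorem GompfEquiv.flip {A B : CSMatrix} (h : A.GompfEquiv B) : A.flip.GompfEquiv B.flip := by
  induction h with
  | rel A B h =>
    rcases h with h | ⟨t, k, rfl, rfl⟩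
    · exact gompfEquiv_of_similar h.flip
    · obtain ⟨u, hu1, hu2, hu3, hu⟩ := exists_flip_X t
      obtain ⟨v, hv1, hv2, hv3, hv⟩ := exists_flip_X (t.shift k)
      refine (gompfEquiv_of_similar hu).trans ((gompfEquiv_shift u k).trans
        (gompfEquiv_of_similar (Similar.trans (X_similar_of_modEq ?_ ?_ ?_) hv.symm)))
      · change u.n + k * u.d = v.n
        rw [hu1, hu2, hv1]
        change _ = 5 - (t.n + k * t.d)
        ring
      · exact hu2.trans hv2.symm
      · change u.c ≡ v.c [ZMOD u.d]
        refine Int.modEq_iff_dvd.2 ⟨k * t.c, ?_⟩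
        rw [hu3, hv3, hu2]
        change t.c ^ 2 + (1 - (t.n + k * t.d)) * t.c + 1 - _ = _
        ring
  | refl A => exact .refl _
  | symm A B _ ih => exact .symm _ _ ih
  | trans A B C _ _ h1 h2 => exact h1.trans h2

/-- For `d = 1` the trace can be shifted to any value, and `c` is irrelevant modulo 1. -/
theorem gompfEquiv_of_d_eq_one (t : CSTriple) (h : t.d = 1) : t.X.GompfEquiv (matA 0) := by
  refine (gompfEquiv_shift t (2 - t.n)).trans (gompfEquiv_of_similar (X_similar_of_modEq ?_ ?_ ?_))
  · change t.n + (2 - t.n) * t.d = 0 + 2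
    rw [h]; ring
  · exact h
  · change t.c ≡ 1 [ZMOD t.d]
    rw [h]; exact Int.modEq_one

end CSMatrix

open CSMatrix

theorem GompfConjectureTrueFor.flip {n : ℤ} (h : GompfConjectureTrueFor n) :
    GompfConjectureTrueFor (5 - n) := by
  intro A hA
  have h1 := (h A.flip (by rw [trace_flip, hA]; ring)).flip
  rw [CSMatrix.flip_flip] at h1
  refine h1.trans ?_
  obtain ⟨u, hu1, hu2, hu3, hu⟩ := exists_flip_X ⟨1, 1, 0 + 2, one_ne_zero, one_dvd _⟩
  have hdvd : (1 : ℤ) ∣ f u.n u.c := one_dvd _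
  exact (gompfEquiv_of_similar (hu.trans (X_similar_of_neg
    (t := ⟨u.c, 1, u.n, one_ne_zero, hdvd⟩) rfl hu2 rfl))).trans (gompfEquiv_of_d_eq_one _ rfl)

end CappellShaneson

namespace CappellShaneson

/-! ### Kernel-friendly searches -/

namespace Search

/-- `p i` holds for all `i < k`. -/
def allBelow (p : ℕ → Bool) (k : ℕ) : Bool :=
  Nat.rec true (fun i r => bif p i then r else false) k

/-- `p k`, written so that the kernel evaluates `k` first. -/
def force (k : ℕ) (p : ℕ → Bool) : Bool :=
  Nat.rec (p 0) (fun i _ => p (Nat.succ i)) k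

/-- The value `|f_n(X, Y)|` or `|f_n(X, -Y)|`. -/
def absForm (n : ℕ) (σ : Bool) (X Y : ℕ) : ℕ :=
  (fun a b => bif σ then Nat.add (Nat.sub a b) (Nat.sub b a) else Nat.add a b)
    (Nat.mul X (Nat.add (Nat.mul X X) (Nat.mul (Nat.pred n) (Nat.mul Y Y))))
    (Nat.mul Y (Nat.add (Nat.mul n (Nat.mul X X)) (Nat.mul Y Y)))

/-- The signed vector `(X, Y)` or `(X, -Y)` is primitive and lies in the lattice of `(c, d)`. -/
def mem (c d : ℕ) (σ : Bool) (X Y : ℕ) : Bool :=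
  Nat.beq (Nat.gcd X Y) 1 &&
    bif σ then Nat.beq (X % d) (c * Y % d) else Nat.beq ((X + c * Y) % d) 0

/-- One of the vectors produced by the subtractive Euclidean algorithm satisfies `p`. -/
def scanAux (p : Bool → ℕ → ℕ → Bool) (fuel : ℕ) : ℕ → ℕ → ℕ → ℕ → Bool :=
  Nat.rec (fun _ _ _ _ => false) (fun _ ih x y u v =>
    bif Nat.beq (Nat.mul x u) 0 then false
    else bif Nat.ble x u then
      force (Nat.sub u x) fun u' => force (Nat.add v y) fun v' =>
        bif p false u' v' then true else ih x y u' v'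
    else
      force (Nat.sub x u) fun x' => force (Nat.add y v) fun y' =>
        bif p true x' y' then true else ih x' y' u v) fuel

/-- Some short vector of the lattice `{X ≡ c Y mod d}` satisfies `p`. -/
def scan (p : Bool → ℕ → ℕ → Bool) (c d : ℕ) : Bool :=
  p true c 1 || scanAux p (2 * d) c 1 d 0

/-- A candidate for the inverse of `Y` modulo `D`. -/
def inverse (Y D : ℕ) : ℕ :=
  (Nat.rec (fun _ _ _ _ _ => 0) (fun _ ih σ r₀ r₁ t₀ t₁ =>
    bif Nat.beq r₁ 0 then (bif σ then t₀ else D - t₀)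
    else ih (!σ) r₁ (r₀ % r₁) t₁ (t₀ + r₀ / r₁ * t₁)) 20 : Bool → ℕ → ℕ → ℕ → ℕ → ℕ)
    false D (Y % D) 0 1

/-- One step leads to a standard matrix with an entry `D = 1` or `lo ≤ D ≤ hi`. -/
def direct (n lo hi c d : ℕ) : Bool :=
  scan (fun σ X Y => force (absForm n σ X Y) fun a =>
    (Nat.beq a d || (Nat.ble (lo * d) a && Nat.ble a (hi * d))) && mem c d σ X Y) c d

/-- Two steps lead to a standard matrix with a smaller entry `d`. -/
def descent (n c d : ℕ) : Bool :=
  scan (fun σ X Y => force (absForm n σ X Y) fun a =>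
    Nat.ble a (4 * d * d) && mem c d σ X Y && force (a / d) fun D =>
      force ((bif σ then X else D - X % D) * inverse Y D % D) fun C =>
        (bif σ then Nat.beq (C * Y % D) (X % D) else Nat.beq ((C * Y + X) % D) 0) &&
        scan (fun τ Z W => force (absForm n τ Z W) fun b =>
          Nat.blt b (d * D) && mem C D τ Z W) C D) c d

/-- One step leads to a standard matrix with an entry `D ≤ K`. -/
def bounded (n K c d : ℕ) : Bool :=
  scan (fun σ X Y => Nat.ble (absForm n σ X Y) (K * d) && mem c d σ X Y) c d

/-- The product of the values `|f_n(c)|` for `16 i ≤ c < 16 (i + 1)`. -/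
def blockProd (n i : ℕ) : ℕ :=
  Nat.rec 1 (fun r a => a * absForm n true (16 * i + r) 1) 16

/-- `p c d` holds for all odd `d ≤ K` and all `c < d` with `d ∣ f_n(c)`. -/
def allRoots (n K : ℕ) (p : ℕ → ℕ → Bool) : Bool :=
  allBelow (fun i => force (blockProd n i) fun P => force (8 * i) fun m =>
    allBelow (fun j =>
      bif Nat.beq (Nat.mod P (Nat.succ (Nat.mul 2 (Nat.add m j)))) 0 then
        force (2 * (m + j) + 1) fun d =>
        allBelow (fun r => force (16 * i + r) fun c =>
          bif Nat.ble d c then true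
          else bif Nat.beq (Nat.mod (absForm n true c 1) d) 0 then p c d
          else true) 16
      else true) (K / 2 + 1 - m)) (K / 16 + 1)

/-- The search for cyclic vectors in the dual plane of a Hessenberg matrix. -/
def cyclic (n K c g z e : ℕ) : Bool :=
  scan (fun σ X Y => Nat.ble (g * absForm n σ X Y) (K * e) && mem z e σ X Y &&
    Nat.beq (Int.gcd ((X : ℤ) * X - ((n : ℤ) - c) * X * (bif σ then (Y : ℤ) else -Y) +
      ((n : ℤ) - 1 - c * ((n : ℤ) - c)) * (Y * Y)) g) 1) z e

/-- Every Hessenberg matrix with first subdiagonal entry `g` that is minimal and small has a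
cyclic vector leading to a standard matrix with an entry at most `K'`. -/
def checkHess (n K K' g : ℕ) : Bool :=
  allBelow (fun c =>
    bif Nat.ble (g * g * g) K && Nat.beq (absForm n true c 1 % g) 0 &&
      Nat.ble (g * g * g) (absForm n true c 1) then
      allBelow (fun e => allBelow (fun z =>
        bif Nat.beq (absForm n true z 1 % (e + 1)) 0 then cyclic n K' c g z (e + 1) else true)
          (e + 1)) (K / (g * g))
    else true) g

theorem allBelow_spec {p : ℕ → Bool} {k : ℕ} (h : allBelow p k = true) {i : ℕ} (hi : i < k) :
    p i = true := by
  induction k with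
  | zero => omega
  | succ k ih =>
    change (bif p k then allBelow p k else false) = true at h
    rcases hp : p k
    · simp [hp] at h
    · rw [hp, cond_true] at h
      rcases Nat.lt_succ_iff_lt_or_eq.1 hi with hi | rfl
      exacts [ih h hi, hp]

@[simp]
theorem force_eq (k : ℕ) (p : ℕ → Bool) : force k p = p k := by
  cases k <;> rfl

/-- Only soundness matters: `p` rechecks lattice membership, so neither the amount of fuel nor the
Euclidean invariant has to be justified. -/
theorem scanAux_spec {p : Bool → ℕ → ℕ → Bool} {fuel x y u v : ℕ}
    (h : scanAux p fuel x y u v = true) : ∃ σ X Y, p σ X Y = true := by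
  induction fuel generalizing x y u v with
  | zero => exact absurd h (by simp [scanAux])
  | succ k ih =>
    change (bif Nat.beq (Nat.mul x u) 0 then false
    else bif Nat.ble x u then
      force (Nat.sub u x) fun u' => force (Nat.add v y) fun v' =>
        bif p false u' v' then true else scanAux p k x y u' v'
    else
      force (Nat.sub x u) fun x' => force (Nat.add y v) fun y' =>
        bif p true x' y' then true else scanAux p k x' y' u v) = true at h
    simp only [force_eq] at h
    rcases hq : Nat.beq (Nat.mul x u) 0
    · rw [hq, cond_false] at h
      rcases hr : Nat.ble x u
      · rw [hr, cond_false] at h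
        rcases hp : p true (Nat.sub x u) (Nat.add y v)
        · rw [hp] at h
          exact ih h
        · exact ⟨_, _, _, hp⟩
      · rw [hr, cond_true] at h
        rcases hp : p false (Nat.sub u x) (Nat.add v y)
        · rw [hp] at h
          exact ih h
        · exact ⟨_, _, _, hp⟩
    · rw [hq, cond_true] at h
      exact absurd h (by simp)

theorem scan_spec {p : Bool → ℕ → ℕ → Bool} {c d : ℕ} (h : scan p c d = true) :
    ∃ σ X Y, p σ X Y = true := by
  rcases Bool.or_eq_true_iff.1 h with h | h
  exacts [⟨_, _, _, h⟩, scanAux_spec h]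

/-- `Y` or `-Y`, according to the sign `σ`. -/
def signed (σ : Bool) (Y : ℕ) : ℤ := bif σ then Y else -Y

theorem absForm_eq {n : ℕ} (hn : 1 ≤ n) (σ : Bool) (X Y : ℕ) :
    (absForm n σ X Y : ℤ) = |form n X (signed σ Y)| := by
  obtain ⟨m, rfl⟩ := Nat.exists_eq_add_of_le' hn
  cases σ
  · have h : form ((m + 1 : ℕ) : ℤ) X (signed false Y) =
        ((X * (X * X + m * (Y * Y)) + Y * ((m + 1) * (X * X) + Y * Y) : ℕ) : ℤ) := by
      simp only [form, signed, cond_false]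
      push_cast
      ring
    rw [h, Nat.abs_cast]
    rfl
  · have h : form ((m + 1 : ℕ) : ℤ) X (signed true Y) =
        ((X * (X * X + m * (Y * Y)) : ℕ) : ℤ) - ((Y * ((m + 1) * (X * X) + Y * Y) : ℕ) : ℤ) := by
      simp only [form, signed, cond_true]
      push_cast
      ring
    rw [h]
    have key : ∀ a b : ℕ, ((a - b + (b - a) : ℕ) : ℤ) = |(a : ℤ) - b| := by
      intro a b
      rcases le_total a b with hab | hab
      · rw [abs_of_nonpos (by omega)]
        omega
      · rw [abs_of_nonneg (by omega)]
        omega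
    exact key _ _

theorem absForm_one {n : ℕ} (hn : 1 ≤ n) (c : ℕ) : (absForm n true c 1 : ℤ) = |f n c| := by
  rw [absForm_eq hn, ← form_one]
  simp [signed]

theorem mem_spec {c d : ℕ} {σ : Bool} {X Y : ℕ} (h : mem c d σ X Y = true) :
    IsCoprime (X : ℤ) (signed σ Y) ∧ (d : ℤ) ∣ X - c * signed σ Y := by
  obtain ⟨h1, h2⟩ := Bool.and_eq_true_iff.1 h
  have h1 : IsCoprime (X : ℤ) Y := Nat.isCoprime_iff_coprime.2 (Nat.eq_of_beq_eq_true h1)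
  cases σ
  · refine ⟨h1.neg_right, ?_⟩
    have h3 := Nat.dvd_of_mod_eq_zero (Nat.eq_of_beq_eq_true h2)
    simp only [signed, cond_false, mul_neg, sub_neg_eq_add]
    exact_mod_cast h3
  · refine ⟨h1, ?_⟩
    have h3 : X ≡ c * Y [MOD d] := Nat.eq_of_beq_eq_true h2
    have := (Nat.modEq_iff_dvd.1 h3.symm)
    simpa [signed] using this

theorem absForm_dvd_blockProd (n i : ℕ) {r : ℕ} (hr : r < 16) :
    absForm n true (16 * i + r) 1 ∣ blockProd n i := by
  have key : ∀ k, r < k → absForm n true (16 * i + r) 1 ∣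
      (Nat.rec 1 (fun r a => a * absForm n true (16 * i + r) 1) k : ℕ) := by
    intro k hk
    induction k with
    | zero => omega
    | succ k ih =>
      rcases Nat.lt_succ_iff_lt_or_eq.1 hk with hk | rfl
      · exact (ih hk).mul_right _
      · exact Dvd.intro_left _ rfl
  exact key 16 hr

/-- A divisor of one value in a block of sixteen divides the block product, so the test on the
product discards no root. Since `d > c`, the block starting at `16 i` needs only odd `d ≥ 16 i + 1`.
-/
theorem allRoots_spec {n K : ℕ} {p : ℕ → ℕ → Bool} (h : allRoots n K p = true) {c d : ℕ}
    (hcd : c < d) (hd : Odd d) (hdK : d ≤ K) (hdvd : d ∣ absForm n true c 1) :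
    p c d = true := by
  obtain ⟨m, rfl⟩ := hd
  have h1 := allBelow_spec h (i := c / 16) (by omega)
  simp only [force_eq] at h1
  have h2 := allBelow_spec h1 (i := m - 8 * (c / 16)) (by omega)
  have hm : 8 * (c / 16) + (m - 8 * (c / 16)) = m := by omega
  have hP : Nat.beq (Nat.mod (blockProd n (c / 16))
      (Nat.succ (Nat.mul 2 (Nat.add (8 * (c / 16)) (m - 8 * (c / 16)))))) 0 = true := by
    change Nat.beq (blockProd n (c / 16) % (2 * (8 * (c / 16) + (m - 8 * (c / 16))) + 1)) 0 = true
    rw [hm, Nat.beq_eq]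
    refine Nat.mod_eq_zero_of_dvd (hdvd.trans ?_)
    have := absForm_dvd_blockProd n (c / 16) (Nat.mod_lt c (by norm_num : 16 > 0))
    rwa [Nat.div_add_mod] at this
  rw [hP, cond_true, hm] at h2
  have h3 := allBelow_spec h2 (Nat.mod_lt c (by norm_num : 16 > 0))
  rw [Nat.div_add_mod] at h3
  have h4 : Nat.ble (2 * m + 1) c = false := by
    rw [← Bool.not_eq_true, Nat.ble_eq]
    omega
  have h5 : Nat.beq (Nat.mod (absForm n true c 1) (2 * m + 1)) 0 = true := by
    rw [Nat.beq_eq]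
    exact Nat.mod_eq_zero_of_dvd hdvd
  rwa [h4, cond_false, h5, cond_true] at h3

theorem checkHess_spec {n K K' g : ℕ} (h : checkHess n K K' g = true) {c z e : ℕ}
    (hc : c < g) (hgK : g * g * g ≤ K) (hgc : g ∣ absForm n true c 1)
    (hmin : g * g * g ≤ absForm n true c 1) (hz : z < e) (heK : g * g * e ≤ K)
    (hez : e ∣ absForm n true z 1) : cyclic n K' c g z e = true := by
  have h1 := allBelow_spec h hc
  have h2 : (Nat.ble (g * g * g) K && Nat.beq (absForm n true c 1 % g) 0 &&
      Nat.ble (g * g * g) (absForm n true c 1)) = true := by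
    simp only [Bool.and_eq_true, Nat.ble_eq, Nat.beq_eq]
    exact ⟨⟨hgK, Nat.mod_eq_zero_of_dvd hgc⟩, hmin⟩
  rw [h2, cond_true] at h1
  have hg : 0 < g * g := Nat.mul_pos (by omega) (by omega)
  have he : e ≤ K / (g * g) := (Nat.le_div_iff_mul_le hg).2 (by rwa [mul_comm])
  have h3 := allBelow_spec h1 (i := e - 1) (by omega)
  rw [Nat.sub_add_cancel (by omega)] at h3
  have h4 := allBelow_spec h3 hz
  have h5 : Nat.beq (absForm n true z 1 % e) 0 = true := by
    rw [Nat.beq_eq]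
    exact Nat.mod_eq_zero_of_dvd hez
  rwa [h5, cond_true] at h4

theorem direct_spec {n lo hi c d : ℕ} (hn : 1 ≤ n) (h : direct n lo hi c d = true) :
    ∃ X Y : ℤ, IsCoprime X Y ∧ (d : ℤ) ∣ X - c * Y ∧
      (|form n X Y| = d ∨ (lo * d : ℤ) ≤ |form n X Y| ∧ |form n X Y| ≤ hi * d) := by
  obtain ⟨σ, X, Y, h⟩ := scan_spec h
  simp only [force_eq, Bool.and_eq_true, Bool.or_eq_true, Nat.ble_eq, Nat.beq_eq] at h
  obtain ⟨h1, h2⟩ := h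
  obtain ⟨h3, h4⟩ := mem_spec h2
  refine ⟨X, signed σ Y, h3, h4, ?_⟩
  rw [← absForm_eq hn]
  exact_mod_cast h1

theorem bounded_spec {n K c d : ℕ} (hn : 1 ≤ n) (h : bounded n K c d = true) :
    ∃ X Y : ℤ, IsCoprime X Y ∧ (d : ℤ) ∣ X - c * Y ∧ |form n X Y| ≤ K * d := by
  obtain ⟨σ, X, Y, h⟩ := scan_spec h
  simp only [Bool.and_eq_true, Nat.ble_eq] at h
  obtain ⟨h1, h2⟩ := h
  obtain ⟨h3, h4⟩ := mem_spec h2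
  refine ⟨X, signed σ Y, h3, h4, ?_⟩
  rw [← absForm_eq hn]
  exact_mod_cast h1

theorem descent_spec {n c d : ℕ} (hn : 1 ≤ n) (h : descent n c d = true) :
    ∃ X Y C Z W : ℤ, ∃ D : ℕ, IsCoprime X Y ∧ (d : ℤ) ∣ X - c * Y ∧ D = |form n X Y| / d ∧
      C * Y ≡ X [ZMOD D] ∧ IsCoprime Z W ∧ (D : ℤ) ∣ Z - C * W ∧ |form n Z W| < d * D := by
  obtain ⟨σ, X, Y, h⟩ := scan_spec h
  simp only [force_eq, Bool.and_eq_true] at h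
  obtain ⟨⟨-, h2⟩, h⟩ := h
  obtain ⟨h3, h4⟩ := mem_spec h2
  generalize hD : absForm n σ X Y / d = D at h
  -- The candidate inverse need not be correct: the search itself tests the congruence for `C`.
  generalize (bif σ then X else D - X % D) * inverse Y D % D = C at h
  obtain ⟨h5, h⟩ := h
  obtain ⟨τ, Z, W, h⟩ := scan_spec h
  simp only [Bool.and_eq_true, Nat.blt_eq] at h
  obtain ⟨h6, h7⟩ := h
  obtain ⟨h8, h9⟩ := mem_spec h7
  refine ⟨X, signed σ Y, C, Z, signed τ W, D, h3, h4, ?_, ?_, h8, h9, ?_⟩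
  · rw [← absForm_eq hn, ← hD]
    norm_cast
  · cases σ
    · have h3 := Nat.dvd_of_mod_eq_zero (Nat.eq_of_beq_eq_true h5)
      rw [Int.modEq_iff_dvd]
      simp only [signed, cond_false, mul_neg, sub_neg_eq_add]
      rw [add_comm]
      exact_mod_cast h3
    · have h3 : C * Y ≡ X [MOD D] := Nat.eq_of_beq_eq_true h5
      simpa [signed] using (Int.natCast_modEq_iff.2 h3)
  · rw [← absForm_eq hn]
    exact_mod_cast h6

theorem cyclic_spec {n K c g z e : ℕ} (hn : 1 ≤ n) (h : cyclic n K c g z e = true) :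
    ∃ X Y : ℤ, IsCoprime X Y ∧ (e : ℤ) ∣ X - z * Y ∧ g * |form n X Y| ≤ K * e ∧
      IsCoprime (X ^ 2 - (n - c) * X * Y + (n - 1 - c * (n - c)) * Y ^ 2) (g : ℤ) := by
  obtain ⟨σ, X, Y, h⟩ := scan_spec h
  simp only [Bool.and_eq_true, Nat.ble_eq, Nat.beq_eq] at h
  obtain ⟨⟨h1, h2⟩, h5⟩ := h
  obtain ⟨h3, h4⟩ := mem_spec h2
  refine ⟨X, signed σ Y, h3, h4, ?_, ?_⟩
  · rw [← absForm_eq hn]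
    exact_mod_cast h1
  · rw [Int.isCoprime_iff_gcd_eq_one, ← h5]
    congr 1
    cases σ <;> simp only [signed, cond_true, cond_false] <;> ring

end Search

end CappellShaneson

/-! ### Gompf equivalence through duality steps -/

namespace CappellShaneson

theorem odd_f (n c : ℤ) : Odd (f n c) := by
  have h : f n c = c * (c - 1) * (c + 1 - n) - 1 := by
    rw [f]
    ring
  rw [h]
  exact ((Int.even_mul_pred_self c).mul_right _).sub_odd odd_one

theorem dvd_form {n c d X Y : ℤ} (h : d ∣ f n c) (hXY : d ∣ X - c * Y) : d ∣ form n X Y := by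
  have heq : form n X Y = Y ^ 3 * f n c + (X - c * Y) *
      (X ^ 2 + c * X * Y + c ^ 2 * Y ^ 2 - n * Y * (X + c * Y) + (n - 1) * Y ^ 2) := by
    rw [form, f]
    ring
  rw [heq]
  exact dvd_add (h.mul_left _) (hXY.mul_right _)

theorem dvd_f_of_modEq {n c c' d : ℤ} (h : c ≡ c' [ZMOD d]) (hc : d ∣ f n c) : d ∣ f n c' := by
  have heq : f n c' = f n c + (c' - c) *
      (c' ^ 2 + c' * c + c ^ 2 - n * (c' + c) + (n - 1)) := by
    simp only [f]
    ring
  rw [heq]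
  exact dvd_add hc (h.dvd.mul_right _)

/-- Every standard matrix with parameters `n`, `d` and `c` modulo `d` (if `b` is false, its
transpose) is Gompf equivalent to `A_0`. -/
def Good (b : Bool) (n c d : ℤ) : Prop :=
  ∀ t : CSTriple, t.n = n → t.d = d → t.c ≡ c [ZMOD d] →
    (bif b then t.X else t.X.transpose).GompfEquiv (matA 0)

theorem Good.congr {b : Bool} {n c c' d : ℤ} (h : Good b n c d) (hc : c' ≡ c [ZMOD d]) :
    Good b n c' d :=
  fun t hn hd ht => h t hn hd (ht.trans hc)

theorem GompfConjectureTrueFor.good {n : ℤ} (h : GompfConjectureTrueFor n) (b : Bool)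
    (c d : ℤ) : Good b n c d := by
  intro t hn _ _
  apply h
  cases b
  · exact t.X.trace_transpose.trans ((CSMatrix.trace_X t).trans hn)
  · exact (CSMatrix.trace_X t).trans hn

theorem good_one (n c : ℤ) : Good true n c 1 :=
  fun t _ hd _ => CSMatrix.gompfEquiv_of_d_eq_one t hd

theorem Good.of_shift {n c d : ℤ} (k : ℤ) (h : Good true (n + k * d) c d) : Good true n c d := by
  intro t hn hd hc
  exact (CSMatrix.gompfEquiv_shift t k).trans
    (h (t.shift k) (by rw [← hn, ← hd]; rfl) hd hc)

theorem Good.of_step {b : Bool} {n c d X Y D : ℤ} (hd : 0 < d) (hXY : IsCoprime X Y)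
    (hmem : d ∣ X - c * Y) (hD : |form n X Y| = d * D)
    (h : ∀ C, C * Y ≡ X [ZMOD D] → Good (!b) n C D) : Good b n c d := by
  rintro t rfl rfl hc
  have hmem' : t.d ∣ X - t.c * Y := by
    have h1 := dvd_add hmem (hc.dvd.mul_right Y)
    rwa [show X - c * Y + (c - t.c) * Y = X - t.c * Y by ring] at h1
  obtain ⟨u, hu1, hu2, hu3, hu⟩ := CSMatrix.exists_similar_transpose_X t hd hXY hmem' hD
  have h1 := h u.c hu3 u hu1 hu2 (.refl _)
  cases b
  · exact (CSMatrix.gompfEquiv_of_similar hu).trans h1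
  · exact (CSMatrix.gompfEquiv_of_similar hu.transpose).trans h1

/-- A solution of `C Y ≡ X mod D` makes `Y` invertible modulo `D`, as `X` and `Y` are coprime; hence
one residue `C` suffices. -/
theorem Good.of_step' {b : Bool} {n c d X Y D C : ℤ} (hd : 0 < d) (hXY : IsCoprime X Y)
    (hmem : d ∣ X - c * Y) (hD : |form n X Y| = d * D) (hC : C * Y ≡ X [ZMOD D])
    (h : Good (!b) n C D) : Good b n c d := by
  refine .of_step hd hXY hmem hD fun C' hC' => h.congr ?_
  have hY : IsCoprime D Y := by
    obtain ⟨k, hk⟩ := hC.dvd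
    have : IsCoprime (D * k) Y := by
      rw [← hk, sub_eq_add_neg, ← neg_mul]
      exact hXY.add_mul_right_left _
    exact this.of_mul_left_left
  have h1 : C' * Y ≡ C * Y [ZMOD D] := hC'.trans hC.symm
  rw [Int.modEq_iff_dvd, ← sub_mul] at h1
  exact Int.modEq_iff_dvd.2 (hY.dvd_of_dvd_mul_right h1)

/-! ### Explicit equivalences -/

namespace Search

/-- Follow a list `(X, Y, C, k)` of duality steps through vectors `(X, Y)` to the parameter `C`,
with a shift of the trace by `k` times the new parameter `d` where it is allowed, to a trace `m`
with `|2 m - 5| < S` or to `d = 1`. -/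
def follow (S : ℕ) : List (ℤ × ℤ × ℤ × ℤ) → Bool → ℤ → ℤ → ℤ → Bool
  | [], b, n, _, d => b && (d == 1 || decide ((2 * n - 5).natAbs < S))
  | (X, Y, C, k) :: l, b, n, c, d =>
    decide (0 < d ∧ Int.gcd X Y = 1 ∧ (X - c * Y) % d = 0 ∧
      ((form n X Y).natAbs : ℤ) = d * ((form n X Y).natAbs / d) ∧
      (X - C * Y) % ((form n X Y).natAbs / d) = 0) &&
    bif b then k == 0 && follow S l false n C ((form n X Y).natAbs / d)
    else follow S l true (n + k * ((form n X Y).natAbs / d)) C ((form n X Y).natAbs / d)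

/-- Chains of equivalences for the parameters `(n, c, d)` not covered by the searches. -/
def chains : List (ℕ × ℕ × ℕ × List (ℤ × ℤ × ℤ × ℤ)) :=
  [(50, 11, 37, [(11, 1, 11, 0), (3, -10, 125, 0), (14, 13, 48, -1)]),
    (52, 20, 63, [(11, 10, 32, -1), (11, 10, 34, 0), (3, 7, 87, 1)]),
    (55, 149, 231, [(67, 2, 420, 0), (18, -11, 187, 0), (28, 29, 32, -2)]),
    (56, 73, 89, [(2, 11, 78, -1), (9, -4, 52, 0), (16, 17, 69, 1)]),
    (57, 15, 79, [(15, 1, 15, -1), (15, 1, 15, 0), (4, 9, 18, 1)]),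
    (58, 53, 63, [(10, -1, 107, -1), (10, -1, 37, 0), (7, 4, 29, 1)]),
    (58, 53, 75, [(-14, -13, 128, -1), (37, -1, 568, 0), (13, 16, 38, 1)]),
    (58, 101, 123, [(17, 16, 109, -1), (48, -1, 731, 0), (11, 16, 23, 1)]),
    (58, 48, 131, [(13, 3, 109, -1), (48, -1, 731, 0), (11, 16, 23, 1)]),
    (61, 85, 103, [(13, 5, 119, -1), (1, -22, 282, 0), (16, 13, 302, 1), (16, 13, 61, 0),
      (1, 17, 114, -1)]),
    (64, 74, 87, [(13, -1, 146, -1), (13, -1, 82, 0), (4, 7, 26, 1)]),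
    (64, 122, 261, [(17, -2, 80, 0), (80, 1, 80, 0), (19, 23, 146, -1), (13, -1, 82, 0),
      (4, 7, 26, 1)]),
    (66, 27, 37, [(27, 1, 27, 0), (8, 27, 215, 0), (1, 46, 64, -1)]),
    (67, 26, 81, [(26, 1, 26, 0), (17, 13, 44, 0), (1, -21, 174, -1), (41, -1, 824, 0),
      (4, 21, 196, 1), (13, 4, 51, 0), (1, 15, 27, -1)]),
    (67, 92, 111, [(19, -1, 272, -1), (19, -1, 250, 0), (3, 14, 142, 1), (3, 14, 14, 0),
      (14, 1, 14, -1)]),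
    (68, 80, 97, [(17, -1, 248, -1), (17, -1, 192, 0), (5, 12, 170, 1), (5, 12, 18, 0),
      (18, 1, 18, -1), (18, 1, 18, 0), (8, 11, 38, 1), (38, 1, 38, 0), (5, 18, 139, -1),
      (88, -1, 50, 0), (5, 7, 70, 1)]),
    (69, 80, 181, [(80, 1, 80, 0), (4, 21, 40, 0), (9, -5, 167, -1), (1, -24, 71, 0),
      (14, 5, 218, 1), (14, 5, 234, 0), (1, 21, 36, -1)]),
    (71, 62, 79, [(5, 9, 133, -1), (16, -1, 99, 0), (3, 7, 44, 1)]),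
    (72, 29, 95, [(8, -3, 134, -1), (1, -26, 43, 0), (14, 9, 52, 1), (14, 9, 230, 0),
      (1, 19, 46, -1)]),
    (72, 144, 203, [(26, 3, 376, 0), (7, 22, 164, 0), (18, 17, 29, -1)]),
    (74, 121, 191, [(13, 8, 174, -1), (23, -1, 260, 0), (7, 12, 112, 1)]),
    (78, 15, 29, [(1, 2, 3, -28)]),
    (78, 19, 83, [(5, 9, 18, -1), (18, 1, 18, 0), (7, 11, 38, 1)]),
    (78, 93, 131, [(4, -7, 158, -1), (27, -1, 304, 0), (7, 12, 84, 1)]),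
    (78, 111, 131, [(2, 13, 35, -1), (11, -4, 75, 0), (20, 21, 107, 1)])]

/-- One of the listed chains starts at `(n, c, d)` and is valid. -/
def chain (n S c d : ℕ) : Bool :=
  chains.any fun e => Nat.beq e.1 n && Nat.beq e.2.1 c && Nat.beq e.2.2.1 d &&
    follow S e.2.2.2 false n c d

/-- The finite verification for trace `n`, when the traces `m` with `|2 m - 5| < S` are known. -/
def checkTrace (n S : ℕ) : Bool :=
  -- `K` is the bound from reduction theory. Any `K' ≤ K` would be sound: a smaller one asks more of
  -- `checkHess`, a larger one adds untransposed cases.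
  force (4 * (n + 2) * (n + 2) / 27) fun K => force (18 * K / 25) fun K' =>
  -- For `lo ≤ D ≤ hi` the shifted trace `n - D` satisfies `|2 (n - D) - 5| < S`.
  force ((2 * n - 5 - S) / 2 + 1) fun lo => force ((2 * n - 5 + S) / 2 - 1) fun hi =>
    allRoots n K (fun c d => (direct n lo hi c d || (descent n c d || chain n S c d)) &&
      (Nat.blt K' d || (Nat.ble lo d && Nat.ble d hi || bounded n K c d))) &&
    (checkHess n K K' 3 && checkHess n K K' 5 && checkHess n K K' 7 && checkHess n K K' 9)

theorem follow_spec {S : ℕ} (hS : ∀ m : ℤ, |2 * m - 5| < S → GompfConjectureTrueFor m)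
    {l : List (ℤ × ℤ × ℤ × ℤ)} {b : Bool} {n c d : ℤ} (h : follow S l b n c d = true) :
    Good b n c d := by
  induction l generalizing b n c d with
  | nil =>
    simp only [follow, Bool.and_eq_true, Bool.or_eq_true, beq_iff_eq, decide_eq_true_eq] at h
    obtain ⟨rfl, rfl | h⟩ := h
    · exact good_one n c
    · refine (hS n ?_).good _ _ _
      rw [Int.abs_eq_natAbs]
      exact_mod_cast h
  | cons v l ih =>
    obtain ⟨X, Y, C, k⟩ := v
    rw [follow, Bool.and_eq_true, decide_eq_true_eq] at h
    obtain ⟨⟨hd, hXY, hmem, hD, hC⟩, h⟩ := h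
    rw [← Int.abs_eq_natAbs] at hD hC h
    refine .of_step' hd (Int.isCoprime_iff_gcd_eq_one.2 hXY) (Int.dvd_of_emod_eq_zero hmem) hD
      (Int.modEq_iff_dvd.2 (Int.dvd_of_emod_eq_zero hC)) ?_
    cases b
    · exact .of_shift k (ih h)
    · exact ih (Bool.and_eq_true_iff.1 h).2

theorem chain_spec {n S c d : ℕ} (hS : ∀ m : ℤ, |2 * m - 5| < S → GompfConjectureTrueFor m)
    (h : chain n S c d = true) : Good false n c d := by
  obtain ⟨e, -, h⟩ := List.any_eq_true.1 h
  exact follow_spec hS (Bool.and_eq_true_iff.1 h).2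

end Search

/-! ### Soundness of the verification for one trace -/

open Search

variable {n S K K' lo hi : ℕ}

/-- The parameters of a standard matrix, reduced, as natural numbers. -/
theorem exists_reduced {n : ℕ} (hn : 1 ≤ n) {c d : ℤ} (hd : 0 < d) (h : d ∣ f n c) :
    ∃ c' d' : ℕ, (d' : ℤ) = d ∧ c ≡ c' [ZMOD d] ∧ c' < d' ∧ Odd d' ∧ d' ∣ absForm n true c' 1 := by
  lift d to ℕ using hd.le
  have h0 := Int.emod_nonneg c hd.ne'
  have h1 := Int.emod_lt_of_pos c hd
  have hc : c ≡ c % d [ZMOD d] := (Int.mod_modEq c d).symm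
  generalize c % d = c' at h0 h1 hc
  lift c' to ℕ using h0
  have h2 := dvd_f_of_modEq hc h
  refine ⟨c', d, rfl, hc, by exact_mod_cast h1, ?_, ?_⟩
  · obtain ⟨k, hk⟩ := h2
    have := odd_f n c'
    rw [hk, Int.odd_mul] at this
    exact_mod_cast this.1
  · rw [← Int.natCast_dvd_natCast, absForm_one hn]
    exact (dvd_abs _ _).2 h2

theorem exists_abs_form_eq {n c d X Y : ℤ} (h : d ∣ f n c) (hXY : d ∣ X - c * Y) :
    ∃ D, |form n X Y| = d * D :=
  (dvd_abs _ _).2 (dvd_form h hXY)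

theorem Good.of_dvd {b : Bool} {n c d : ℤ} (h : d ≠ 0 → d ∣ f n c → Good b n c d) :
    Good b n c d := by
  intro t hn hd hc
  refine h (hd ▸ t.d_ne_zero) ?_ t hn hd hc
  subst hd hn
  exact dvd_f_of_modEq hc t.dvd

theorem good_false_of_direct (hn : 1 ≤ n) {c d : ℕ}
    (hlo : ∀ D : ℤ, lo ≤ D → D ≤ hi → GompfConjectureTrueFor (n - D))
    (h : direct n lo hi c d = true) : Good false n c d := by
  refine .of_dvd fun hd hdvd => ?_
  have hd : (0 : ℤ) < d := by omega
  obtain ⟨X, Y, hXY, hmem, h⟩ := direct_spec hn h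
  obtain ⟨D, hD⟩ := exists_abs_form_eq hdvd hmem
  refine .of_step hd hXY hmem hD fun C _ => ?_
  rw [hD] at h
  rcases h with h | ⟨h1, h2⟩
  · obtain rfl : D = 1 := by
      rw [mul_eq_left₀ hd.ne'] at h
      exact h
    exact good_one _ _
  · rw [mul_comm (d : ℤ), mul_le_mul_iff_left₀ hd] at h1 h2
    refine .of_shift (-1) ((?_ : GompfConjectureTrueFor _).good _ _ _)
    rw [neg_one_mul, ← sub_eq_add_neg]
    exact hlo D h1 h2

/-- Two duality steps return to a transpose, with an entry `E` such that `D E < d D`; the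
intermediate `D` may exceed `d`. -/
theorem good_false_of_descent (hn : 1 ≤ n) {c d : ℕ}
    (ih : ∀ d' : ℕ, d' < d → ∀ c', Good false n c' d')
    (h : descent n c d = true) : Good false n c d := by
  refine .of_dvd fun hd hdvd => ?_
  have hd : (0 : ℤ) < d := by omega
  obtain ⟨X, Y, C, Z, W, D, hXY, hmem, hD', hC, hZW, hmem', hlt⟩ := descent_spec hn h
  have hD : |form n X Y| = d * D := by
    rw [hD', Int.mul_ediv_cancel' ((dvd_abs _ _).2 (dvd_form hdvd hmem))]
  refine .of_step' hd hXY hmem hD hC (.of_dvd fun hD0 hDdvd => ?_)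
  have hD0 : (0 : ℤ) < D := by omega
  obtain ⟨E, hE⟩ := exists_abs_form_eq hDdvd hmem'
  have hE0 : 0 ≤ E := by
    refine nonneg_of_mul_nonneg_right ?_ hD0
    rw [← hE]
    exact abs_nonneg _
  lift E to ℕ using hE0
  refine .of_step hD0 hZW hmem' hE fun C' _ => ih E ?_ C'
  rw [hE, mul_comm (d : ℤ)] at hlt
  exact_mod_cast lt_of_mul_lt_mul_left hlt hD0.le

theorem good_true_of_bounded (hn : 1 ≤ n) {c d : ℕ}
    (hK : ∀ d' : ℕ, d' ≤ K → ∀ c', Good false n c' d')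
    (h : bounded n K c d = true) : Good true n c d := by
  refine .of_dvd fun hd hdvd => ?_
  have hd : (0 : ℤ) < d := by omega
  obtain ⟨X, Y, hXY, hmem, hle⟩ := bounded_spec hn h
  obtain ⟨D, hD⟩ := exists_abs_form_eq hdvd hmem
  have hD0 : 0 ≤ D := by
    refine nonneg_of_mul_nonneg_right ?_ hd
    rw [← hD]
    exact abs_nonneg _
  lift D to ℕ using hD0
  refine .of_step hd hXY hmem hD fun C _ => hK D ?_ C
  rw [hD, mul_comm (K : ℤ)] at hle
  exact_mod_cast le_of_mul_le_mul_left hle hd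

theorem good_false_of_allRoots (hn : 1 ≤ n) {S : ℕ} {q : ℕ → ℕ → Bool}
    (hS : ∀ m : ℤ, |2 * m - 5| < S → GompfConjectureTrueFor m)
    (hlo : ∀ D : ℤ, lo ≤ D → D ≤ hi → GompfConjectureTrueFor (n - D))
    (h : allRoots n K (fun c d =>
      (direct n lo hi c d || (descent n c d || chain n S c d)) && q c d) = true)
    (d : ℕ) (hd : d ≤ K) (c : ℤ) : Good false n c d := by
  induction d using Nat.strong_induction_on generalizing c with
  | _ d ih =>
    refine .of_dvd fun hd0 hdvd => ?_
    obtain ⟨c', d', hd', hc, hlt, hodd, hdvd'⟩ := exists_reduced hn (by omega) hdvd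
    obtain rfl : d' = d := by exact_mod_cast hd'
    refine Good.congr ?_ hc
    have h1 := allRoots_spec h hlt hodd hd hdvd'
    simp only [Bool.and_eq_true, Bool.or_eq_true] at h1
    rcases h1.1 with h1 | h1 | h1
    · exact good_false_of_direct hn hlo h1
    · exact good_false_of_descent hn (fun e he c => ih e he (by omega) c) h1
    · exact chain_spec hS h1

/-- An untransposed matrix either shifts directly to a known trace or passes by one duality step to
a transpose with entry at most `K`, already settled. -/
theorem good_true_of_allRoots (hn : 1 ≤ n) {q : ℕ → ℕ → Bool}
    (hlo : ∀ D : ℤ, lo ≤ D → D ≤ hi → GompfConjectureTrueFor (n - D))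
    (hK : ∀ d' : ℕ, d' ≤ K → ∀ c', Good false n c' d') (hKK' : K' ≤ K)
    (h : allRoots n K (fun c d => q c d &&
      (Nat.blt K' d || (Nat.ble lo d && Nat.ble d hi || bounded n K c d))) = true)
    {c d : ℤ} (hd0 : 0 < d) (hd : d ≤ K') : Good true n c d := by
  refine .of_dvd fun _ hdvd => ?_
  obtain ⟨c', d, rfl, hc, hlt, hodd, hdvd'⟩ := exists_reduced hn hd0 hdvd
  refine Good.congr ?_ hc
  have h1 := allRoots_spec h hlt hodd (by omega) hdvd'
  simp only [Bool.and_eq_true, Bool.or_eq_true, Nat.ble_eq, Nat.blt_eq] at h1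
  rcases h1.2 with h1 | h1 | h1
  · omega
  · refine .of_shift (-1) ((?_ : GompfConjectureTrueFor _).good _ _ _)
    rw [neg_one_mul, ← sub_eq_add_neg]
    exact hlo d (by omega) (by omega)
  · exact good_true_of_bounded hn hK h1

theorem CSMatrix.IsHess.exists_transpose_similar_X_of_checkHess (hn : 1 ≤ n) {A : CSMatrix}
    {c x p y q z : ℤ} {g e : ℕ} (h : A.IsHess c x p g y q e z) (hA : A.trace = n) (hg : 0 < g)
    (he : 0 < e) (hmin : ∀ X Y : ℤ, (X ≠ 0 ∨ Y ≠ 0) → (g : ℤ) ∣ X - c * Y →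
      (g : ℤ) ^ 3 ≤ |form A.trace X Y|) (hgK : g * g * g ≤ K) (heK : g * g * e ≤ K)
    (hcheck : checkHess n K K' g = true) :
    ∃ u : CSTriple, u.n = n ∧ 0 < u.d ∧ u.d ≤ K' ∧ A.transpose.Similar u.X := by
  have hgdvd := h.g_dvd
  have hedvd := h.e_dvd
  rw [hA] at hgdvd hedvd hmin
  obtain ⟨c', g', hg', hc, hcg, -, hdvd⟩ := exists_reduced hn (by exact_mod_cast hg) hgdvd
  obtain ⟨z', e', he', hz, hze, -, hdvd'⟩ := exists_reduced hn (by exact_mod_cast he) hedvd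
  obtain rfl : g' = g := by exact_mod_cast hg'
  obtain rfl : e' = e := by exact_mod_cast he'
  have hmin' := hmin c' 1 (Or.inr one_ne_zero) (by simpa using hc.dvd)
  rw [form_one, ← absForm_one hn, pow_three'] at hmin'
  obtain ⟨X, Y, hXY, hmem, hle, hG⟩ := cyclic_spec hn
    (checkHess_spec hcheck hcg hgK hdvd (by exact_mod_cast hmin') hze heK hdvd')
  have hmem' : (e' : ℤ) ∣ X - z * Y := by
    have h1 := dvd_add hmem (hz.dvd.mul_right Y)
    rwa [show X - z' * Y + (z' - z) * Y = X - z * Y by ring] at h1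
  have hG' : IsCoprime (X ^ 2 - (A.trace - c) * X * Y +
      (A.trace - 1 - c * (A.trace - c)) * Y ^ 2) (g' : ℤ) := by
    obtain ⟨k, hk⟩ := hc.dvd
    obtain rfl : c = c' - g' * k := by linarith
    have heq : X ^ 2 - (A.trace - (c' - g' * k)) * X * Y +
        (A.trace - 1 - (c' - g' * k) * (A.trace - (c' - g' * k))) * Y ^ 2 =
        X ^ 2 - (n - c') * X * Y + (n - 1 - c' * (n - c')) * Y ^ 2 +
        (-k * X * Y + (k * (n - c') - c' * k + g' * k ^ 2) * Y ^ 2) * g' := by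
      rw [hA]
      ring
    rw [heq]
    exact hG.add_mul_right_left _
  obtain ⟨D, hD⟩ := exists_abs_form_eq hedvd hmem'
  have he0 : (0 : ℤ) < e' := by exact_mod_cast he
  obtain ⟨u, hu1, hu2, hu⟩ := h.exists_transpose_similar_X (D := g' * D) (by exact_mod_cast hg) he0
    hXY hmem' hG' (by rw [hA, hD]; ring)
  refine ⟨u, hu1.trans hA, ?_, ?_, hu⟩
  · refine lt_of_le_of_ne ?_ u.d_ne_zero.symm
    rw [hu2]
    refine mul_nonneg (Int.natCast_nonneg _) (nonneg_of_mul_nonneg_right ?_ he0)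
    rw [← hD]
    exact abs_nonneg _
  · rw [hu2]
    rw [hD, mul_left_comm, mul_comm (K' : ℤ)] at hle
    exact le_of_mul_le_mul_left hle he0

theorem gompfConjectureTrueFor_of_checkTrace (hn : 3 ≤ n) (hn' : n ≤ 90)
    (hSn : S ≤ 2 * n - 5) (hS : ∀ m : ℤ, |2 * m - 5| < S → GompfConjectureTrueFor m)
    (h : checkTrace n S = true) : GompfConjectureTrueFor n := by
  simp only [checkTrace, force_eq] at h
  set K := 4 * (n + 2) * (n + 2) / 27 with hKdef
  set K' := 18 * K / 25 with hK'def
  set lo := (2 * n - 5 - S) / 2 + 1 with hlodef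
  set hi := (2 * n - 5 + S) / 2 - 1 with hhidef
  obtain ⟨h, hH⟩ := Bool.and_eq_true_iff.1 h
  simp only [Bool.and_eq_true] at hH
  have hn1 : 1 ≤ n := by omega
  have hlo : ∀ D : ℤ, lo ≤ D → D ≤ hi → GompfConjectureTrueFor (n - D) := by
    intro D h1 h2
    refine hS _ (abs_lt.2 ⟨?_, ?_⟩) <;> omega
  have hT : ∀ d : ℕ, d ≤ K → ∀ c, Good false n c d :=
    good_false_of_allRoots hn1 hS hlo h
  have hP : ∀ {c d : ℤ}, 0 < d → d ≤ K' → Good true n c d :=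
    good_true_of_allRoots hn1 hlo hT (by omega) h
  intro A hA
  -- Reducing the transpose makes `g = 1` land on transposes of standard matrices, covered up to
  -- `K`, while `g > 1` lands on standard matrices themselves, needed only up to `K'`.
  obtain ⟨B, hAB, c, x, p, g, y, q, e, z, hB, hg, he, hmin, hg3, hge⟩ :=
    CSMatrix.exists_small_isHess A.transpose (by rw [A.trace_transpose, hA]; exact_mod_cast hn)
  rw [A.trace_transpose, hA] at hg3 hge
  rw [hAB.trace_eq] at hmin
  have hAB' := hAB.of_transpose
  have hBn : B.trace = n := by rw [← hAB.trace_eq, A.trace_transpose, hA]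
  have hgodd : Odd g := by
    obtain ⟨k, hk⟩ := hB.g_dvd
    have := odd_f B.trace c
    rw [hk, Int.odd_mul] at this
    exact this.1
  lift g to ℕ using hg.le
  lift e to ℕ using he.le
  norm_cast at hg he hgodd hg3 hge
  have hgK : g * g * g ≤ K := by
    rw [hKdef, Nat.le_div_iff_mul_le (by norm_num)]
    nlinarith
  have heK : g * g * e ≤ K := by
    rw [hKdef, Nat.le_div_iff_mul_le (by norm_num)]
    nlinarith
  -- This is the use of `n ≤ 90`: `27 * 11 ^ 3 > 4 * 92 ^ 2`. As `g` is odd, only 1, 3, 5, 7, 9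
  -- remain.
  have hg11 : g < 11 := by
    by_contra! hg11
    have h1 : 11 ^ 3 ≤ g ^ 3 := Nat.pow_le_pow_left hg11 3
    have h2 : (n + 2) ^ 2 ≤ 92 ^ 2 := Nat.pow_le_pow_left (by omega) 2
    omega
  have main : checkHess n K K' g = true → A.GompfEquiv (matA 0) := by
    intro hcheck
    obtain ⟨u, hu1, hu2, hu3, hu⟩ :=
      hB.exists_transpose_similar_X_of_checkHess hn1 hBn hg he hmin hgK heK hcheck
    exact (CSMatrix.gompfEquiv_of_similar (hAB'.trans hu)).trans
      (hP hu2 hu3 u hu1 rfl (.refl _))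
  have hg10 : g = 1 ∨ g = 3 ∨ g = 5 ∨ g = 7 ∨ g = 9 := by
    obtain ⟨k, rfl⟩ := hgodd
    omega
  rcases hg10 with rfl | rfl | rfl | rfl | rfl
  · obtain ⟨t, ht1, ht2, ht3, ht⟩ := CSMatrix.IsHess.exists_X (by simpa using hB)
    exact (CSMatrix.gompfEquiv_of_similar (hAB'.trans ht.transpose)).trans
      (hT e (by simpa using heK) t.c t (ht3.trans hBn) ht2 (.refl _))
  exacts [main hH.1.1.1, main hH.1.1.2, main hH.1.2, main hH.2]

end CappellShaneson

/-! ### Kernel computations and induction on the trace -/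

namespace CappellShaneson

open Search

theorem checkTrace_of_mem_Ico (l u : ℕ)
    (h : allBelow (fun i => force (l + i) fun n => checkTrace n (2 * n - 5)) (u - l) = true)
    {n : ℕ} (hl : l ≤ n) (hu : n < u) : checkTrace n (2 * n - 5) = true := by
  have := allBelow_spec h (i := n - l) (by omega)
  rwa [force_eq, Nat.add_sub_cancel' hl] at this

set_option maxRecDepth 100000 in
theorem checkTrace_of_lt_forty_three {n : ℕ} (hl : 3 ≤ n) (hu : n < 43) :
    checkTrace n (2 * n - 5) = true :=
  checkTrace_of_mem_Ico 3 43 (by decide +kernel) hl hu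

set_option maxRecDepth 100000 in
theorem checkTrace_of_lt_fifty_eight {n : ℕ} (hl : 43 ≤ n) (hu : n < 58) :
    checkTrace n (2 * n - 5) = true :=
  checkTrace_of_mem_Ico 43 58 (by decide +kernel) hl hu

set_option maxRecDepth 100000 in
theorem checkTrace_of_lt_seventy {n : ℕ} (hl : 58 ≤ n) (hu : n < 70) :
    checkTrace n (2 * n - 5) = true :=
  checkTrace_of_mem_Ico 58 70 (by decide +kernel) hl hu

set_option maxRecDepth 100000 in
theorem checkTrace_seventy_one : checkTrace 71 135 = true := by decide +kernel

set_option maxRecDepth 100000 in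
theorem checkTrace_seventy_two : checkTrace 72 135 = true := by decide +kernel

set_option maxRecDepth 100000 in
theorem checkTrace_seventy_four : checkTrace 74 135 = true := by decide +kernel

set_option maxRecDepth 100000 in
theorem checkTrace_seventy_eight : checkTrace 78 135 = true := by decide +kernel

theorem gompfConjectureTrueFor_of_three_le {n : ℕ} (hl : 3 ≤ n) (hu : n < 70) :
    GompfConjectureTrueFor n := by
  induction n using Nat.strong_induction_on with
  | _ n ih =>
    refine gompfConjectureTrueFor_of_checkTrace (S := 2 * n - 5) hl (by omega) le_rfl ?_ ?_
    -- The known traces are those with `5 - n < m < n`; the ones below 3 come from `5 - m` by the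
    -- flip.
    · intro m hm
      have h1 := abs_lt.1 hm
      rcases le_or_gt 3 m with h3 | h3
      · lift m to ℕ using by omega
        exact ih m (by omega) (by omega) (by omega)
      · have h2 := ih (5 - m).toNat (by omega) (by omega) (by omega)
        rw [Int.toNat_of_nonneg (by omega)] at h2
        simpa using h2.flip
    · rcases lt_or_ge n 43 with h | h
      · exact checkTrace_of_lt_forty_three hl h
      · rcases lt_or_ge n 58 with h' | h'
        exacts [checkTrace_of_lt_fifty_eight h h', checkTrace_of_lt_seventy h' hu]

theorem gompfConjectureTrueFor_of_abs_lt {n : ℤ} (h : |2 * n - 5| < 135) :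
    GompfConjectureTrueFor n := by
  have h1 := abs_lt.1 h
  rcases le_or_gt 3 n with h3 | h3
  · lift n to ℕ using by omega
    exact gompfConjectureTrueFor_of_three_le (by omega) (by omega)
  · have h2 := gompfConjectureTrueFor_of_three_le (n := (5 - n).toNat) (by omega) (by omega)
    rw [Int.toNat_of_nonneg (by omega)] at h2
    simpa using h2.flip

theorem gompfConjectureTrueFor_of_mem {n : ℕ} (h : n ∈ ({71, 72, 74, 78} : Set ℕ)) :
    GompfConjectureTrueFor n := by
  -- Trace 70 is not available, so these four traces rely only on `-64 ≤ m ≤ 69`, for which `135 = 2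
  -- * 70 - 5` is the bound.
  have hS : ∀ m : ℤ, |2 * m - 5| < (135 : ℕ) → GompfConjectureTrueFor m :=
    fun m hm => gompfConjectureTrueFor_of_abs_lt hm
  simp only [Set.mem_insert_iff, Set.mem_singleton_iff] at h
  refine gompfConjectureTrueFor_of_checkTrace (S := 135) (by omega) (by omega) (by omega) hS ?_
  rcases h with rfl | rfl | rfl | rfl
  exacts [checkTrace_seventy_one, checkTrace_seventy_two, checkTrace_seventy_four,
    checkTrace_seventy_eight]

end CappellShaneson

theorem mainTheorem4 (n : ℤ)
    (hn : (-64 ≤ n ∧ n ≤ 69) ∨ n ∈ ({-73, -69, -67, -66, 71, 72, 74, 78} : Set ℤ)) :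
    CappellShaneson.GompfConjectureTrueFor n := by
  open CappellShaneson in
  have hneg : ∀ m : ℕ, m ∈ ({71, 72, 74, 78} : Set ℕ) → GompfConjectureTrueFor (5 - m) :=
    fun m hm => (gompfConjectureTrueFor_of_mem hm).flip
  simp only [Set.mem_insert_iff, Set.mem_singleton_iff] at hn hneg
  rcases hn with hn | rfl | rfl | rfl | rfl | rfl | rfl | rfl | rfl
  · exact CappellShaneson.gompfConjectureTrueFor_of_abs_lt (abs_lt.2 (by omega))
  · exact hneg 78 (by norm_num)
  · exact hneg 74 (by norm_num)
  · exact hneg 72 (by norm_num)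
  · exact hneg 71 (by norm_num)
  · exact CappellShaneson.gompfConjectureTrueFor_of_mem (n := 71) (by simp)
  · exact CappellShaneson.gompfConjectureTrueFor_of_mem (n := 72) (by simp)
  · exact CappellShaneson.gompfConjectureTrueFor_of_mem (n := 74) (by simp)
  · exact CappellShaneson.gompfConjectureTrueFor_of_mem (n := 78) (by simp)
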